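/- Let $n\ge 2$, $\sigma\in(0,1)$, $c_1,c_2>0$, and let $J:\mathbb{R}^n\times\mathbb{R}^n\to\mathbb{R}$ be a bounded, nonnegative, continuous, symmetric function such that $x\mapsto J(x,y)$ belongs to $L^1(\mathbb{R}^n)$ for every $y\in\mathbb{R}^n$ and $$J(x,y)\ge c_1|x-y|^{-(n+2\sigma)}\qquad\text{whenever } |x-y|>c_2 .$$ Let $u_0\in L^1(\mathbb{R}^n)\cap L^\infty(\mathbb{R}^n)$, and let $u\in C([0,\infty);L^1(\mathbb{R}^n)\cap L^\infty(\mathbb{R}^n))$ be a solution of $$\partial_t u(t,x)=\int_{\mathbb{R}^n}J(x,y)\,[u(t,y)-u(t,x)]\,dy\quad\text{in }(0,\infty)\times\mathbb{R}^n,\qquad u(0,\cdot)=u_0,$$ where the equation holds for all $t>0$ and all $x$ outside a null set that does not depend on $t$. Let $q\in(1,2\sigma]$. Then $$\limsup_{t\to\infty}\;t^{\frac{n}{2\sigma}\left(1-\frac1q\right)}\|u(t,\cdot)\|_{L^q(\mathbb{R}^n)}\le C\,\|u_0\|_{L^1(\mathbb{R}^n)},$$ where $C$ depends only on $n,\sigma,q,c_1,c_2$.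 Moreover, for every real $r>2\sigma$ there is a constant $C$, depending only on $n,\sigma,q,r,c_1,c_2$ (in particular independent of $u_0$), such that for all $t>0$ $$\|u(t,\cdot)\|_{L^q(\mathbb{R}^n)}\le C\max\{\|u_0\|_{L^1(\mathbb{R}^n)},\|u_0\|_{L^r(\mathbb{R}^n)}\}\;t^{-\frac{n}{2\sigma}\left(1-\frac1q\right)} .$$ -/

import Mathlib

open MeasureTheory Filter Topology
open scoped ENNReal NNReal

/-- Kernels `J` on `ℝⁿ × ℝⁿ` that are bounded, nonnegative, continuous, symmetric, integrable in
one variable when the other one is frozen, and satisfy the tail bound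
`J(x,y) ≥ c₁ |x - y|^{-(n+2σ)}` for `|x - y| > c₂`. -/
structure IsFatTailKernel (n : ℕ) (σ c₁ c₂ : ℝ)
    (J : EuclideanSpace ℝ (Fin n) → EuclideanSpace ℝ (Fin n) → ℝ) : Prop where
  bounded : ∃ M : ℝ, ∀ x y, J x y ≤ M
  nonneg : ∀ x y, 0 ≤ J x y
  continuous : Continuous (Function.uncurry J)
  symm : ∀ x y, J x y = J y x
  integrable : ∀ y, Integrable (fun x => J x y) volume
  tail : ∀ x y, c₂ < ‖x - y‖ → c₁ * ‖x - y‖ ^ (-((n : ℝ) + 2 * σ)) ≤ J x y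

/-- `u ∈ C([0,∞); L¹(ℝⁿ) ∩ L^∞(ℝⁿ))` is a solution of
`∂ₜ u(t,x) = ∫ J(x,y) [u(t,y) - u(t,x)] dy` in `(0,∞) × ℝⁿ` with `u(0,·) = u₀`.
The function `u t` represents the class of `u(t,·)` modulo null sets; the equation holds
classically in time, for all `x` outside a null set that does not depend on `t`. The values of
`u t` for negative `t` play no role. -/
structure IsNonlocalHeatSolution {n : ℕ}
    (J : EuclideanSpace ℝ (Fin n) → EuclideanSpace ℝ (Fin n) → ℝ)
    (u₀ : EuclideanSpace ℝ (Fin n) → ℝ) (u : ℝ → EuclideanSpace ℝ (Fin n) → ℝ) : Prop where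
  memLp_one : ∀ t : ℝ, 0 ≤ t → MemLp (u t) 1 volume
  memLp_top : ∀ t : ℝ, 0 ≤ t → MemLp (u t) ∞ volume
  continuous_one : ∀ t : ℝ, 0 ≤ t →
    Tendsto (fun s => eLpNorm (u s - u t) 1 volume) (𝓝[Set.Ici 0] t) (𝓝 0)
  continuous_top : ∀ t : ℝ, 0 ≤ t →
    Tendsto (fun s => eLpNorm (u s - u t) ∞ volume) (𝓝[Set.Ici 0] t) (𝓝 0)
  initial : u 0 =ᵐ[volume] u₀
  equation : ∀ᵐ x ∂(volume : Measure (EuclideanSpace ℝ (Fin n))), ∀ t : ℝ, 0 < t →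
    HasDerivAt (fun s => u s x) (∫ y, J x y * (u t y - u t x)) t

/-!
The decay comes from an `L^q` energy estimate, `1 ≤ q ≤ 2`, on which the kernel acts only through a
dyadic annulus. Write `Y(t) = ∫ |u(t)|^q` and `m = ‖u₀‖₁`. Formally,
`Y' = q ∫∫ J(x,y) |u(x)|^{q-2} u(x) (u(y) - u(x))`, and, after symmetrization, the right-hand side
can only increase when `J` is replaced by the smaller kernel `h · 1_{R < |x-y| < 2R}`, where
`h = c₁ (2R)^{-(n+2σ)}` and `R ≥ c₂`. The loss term is then `-c R^{-2σ} Y`, and, since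
`|s|^{q-1} ≤ l^{q-1} + l^{q-2} |s|` for every level `l > 0`, the choice `l = m R^{-n}` bounds the
gain term by `C R^{-2σ - n(q-1)} m^q` (`IsNonlocalHeatSolution.integral_rpow_le`). On `[t, 2t]` the
radius `R = (t/b)^{1/(2σ)}` with a suitable constant `b` gives, for `Z(t) = t^{n(q-1)/(2σ)} Y(t)`,
`Z(2t) ≤ (Z(t) + D m^q) / 2` once `t` is large, hence `Z(t) ≤ D m^q + O(1/t)`
(`exists_rpow_mul_integral_le`). Both claims follow, the second one with the interpolation of
`‖u₀‖_q` between `‖u₀‖₁` and `‖u₀‖_r`.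

Two points need care because `∫ J(x,y) dy` may be unbounded in `x` and `|u|^{q-1}` need not be
integrable. First, `|s|^q / q` is replaced by a convex function that is quadratic at the origin
(`regPow`). Second, the functional is restricted to bounded sets `E` on which `∫ J(x,y) dy` is
bounded. There it is differentiable in time, the part of the form on `E × E` keeps its sign by
symmetry, and the part on `E × Eᶜ` is controlled by the mass of `u` outside `E`
(`setIntegral_kernel_diff_le`), which vanishes uniformly on compact time intervals as `E` exhausts
the space (`IsNonlocalHeatSolution.integral_convex_le`). The same estimate without dissipation gives
the contraction of the `L¹` and `L^q` norms.
-/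

/-! ### The nonlocal form on a subset -/

theorem integrable_kernel_mul_diff {X : Type*} [MeasurableSpace X] {μ : Measure X} [SFinite μ]
    {P : X → X → ℝ} {M K L : ℝ} {φ : ℝ → ℝ} {v : X → ℝ} {E : Set X}
    (hPm : Measurable (Function.uncurry P)) (hP0 : ∀ x y, 0 ≤ P x y) (hPM : ∀ x y, P x y ≤ M)
    (hPi : ∀ x, Integrable (P x) μ)
    (hE : MeasurableSet E) (hPK : ∀ x ∈ E, ∫ y, P x y ∂μ ≤ K)
    (hφ : Monotone φ) (hφL : ∀ s, |φ s| ≤ L * |s|)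
    (hv : Integrable v μ) (hv2 : Integrable (fun x => v x ^ 2) μ) :
    Integrable (fun z : X × X => P z.1 z.2 * (φ (v z.1) * (v z.2 - v z.1)))
      ((μ.restrict E).prod μ) := by
  have hφv : AEStronglyMeasurable (fun x => φ (v x)) μ :=
    (hφ.measurable.comp_aemeasurable hv.aemeasurable).aestronglyMeasurable
  have hφvi : Integrable (fun x => φ (v x)) μ := by
    refine (hv.norm.const_mul L).mono' hφv (Eventually.of_forall fun x => ?_)
    simpa using hφL (v x)
  have h1 : Integrable (fun z : X × X => P z.1 z.2 * (φ (v z.1) * v z.2))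
      ((μ.restrict E).prod μ) := by
    refine (hφvi.restrict.mul_prod hv).bdd_mul (c := M) hPm.aestronglyMeasurable ?_
    exact Eventually.of_forall fun z => by
      rw [Real.norm_eq_abs]
      exact (abs_of_nonneg (hP0 z.1 z.2)).trans_le (hPM z.1 z.2)
  have h2 : Integrable (fun z : X × X => P z.1 z.2 * (φ (v z.1) * v z.1))
      ((μ.restrict E).prod μ) := by
    have hm : AEStronglyMeasurable (fun x => φ (v x) * v x) (μ.restrict E) :=
      (hφv.mul hv.aestronglyMeasurable).restrict
    have hm2 : AEStronglyMeasurable (fun z : X × X => P z.1 z.2 * (φ (v z.1) * v z.1))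
      ((μ.restrict E).prod μ) := hPm.aestronglyMeasurable.mul hm.comp_fst
    rw [integrable_prod_iff hm2]
    refine ⟨Eventually.of_forall fun x => (hPi x).mul_const (φ (v x) * v x), ?_⟩
    refine (hv2.restrict.const_mul (K * L)).mono' hm2.norm.integral_prod_right' ?_
    filter_upwards [ae_restrict_mem hE] with x hx
    have : ∀ y, ‖P x y * (φ (v x) * v x)‖ = P x y * (|φ (v x)| * |v x|) := fun y => by
      rw [norm_mul, norm_mul, Real.norm_eq_abs, abs_of_nonneg (hP0 x y)]; rfl
    simp only [this, integral_mul_const]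
    have h0 : 0 ≤ ∫ y, P x y ∂μ := integral_nonneg (hP0 x)
    rw [Real.norm_of_nonneg (by positivity)]
    calc (∫ y, P x y ∂μ) * (|φ (v x)| * |v x|) ≤ K * ((L * |v x|) * |v x|) := by
          gcongr
          · exact h0.trans (hPK x hx)
          · exact hPK x hx
          · exact hφL _
      _ = K * L * v x ^ 2 := by rw [← sq_abs (v x)]; ring
  convert h1.sub h2 using 2 with z
  simp only [Pi.sub_apply]; ring

theorem integrableOn_mul_integral_kernel_diff {X : Type*} [MeasurableSpace X] {μ : Measure X}
    [SFinite μ] {P : X → X → ℝ} {M K L : ℝ} {φ : ℝ → ℝ} {v : X → ℝ} {E : Set X}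
    (hPm : Measurable (Function.uncurry P)) (hP0 : ∀ x y, 0 ≤ P x y) (hPM : ∀ x y, P x y ≤ M)
    (hPi : ∀ x, Integrable (P x) μ)
    (hE : MeasurableSet E) (hPK : ∀ x ∈ E, ∫ y, P x y ∂μ ≤ K)
    (hφ : Monotone φ) (hφL : ∀ s, |φ s| ≤ L * |s|)
    (hv : Integrable v μ) (hv2 : Integrable (fun x => v x ^ 2) μ) :
    IntegrableOn (fun x => φ (v x) * ∫ y, P x y * (v y - v x) ∂μ) E μ := by
  have := (integrable_kernel_mul_diff hPm hP0 hPM hPi hE hPK hφ hφL hv hv2).integral_prod_left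
  refine this.congr (Eventually.of_forall fun x => ?_)
  simp only
  rw [← integral_const_mul]
  congr 1 with y
  ring

/-- Testing the nonlocal operator against a monotone function of `v` on a subset `E` yields a
nonpositive contribution from `E × E`, by symmetry of the kernel, so that only the mass of `v`
outside `E` can contribute positively. -/
theorem setIntegral_kernel_diff_le {X : Type*} [MeasurableSpace X] {μ : Measure X} [SFinite μ]
    {P : X → X → ℝ} {M K L : ℝ} {φ : ℝ → ℝ} {v : X → ℝ} {E : Set X}
    (hPm : Measurable (Function.uncurry P)) (hP0 : ∀ x y, 0 ≤ P x y) (hPM : ∀ x y, P x y ≤ M)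
    (hPs : ∀ x y, P x y = P y x) (hPi : ∀ x, Integrable (P x) μ)
    (hE : MeasurableSet E) (hPK : ∀ x ∈ E, ∫ y, P x y ∂μ ≤ K)
    (hφ : Monotone φ) (hφL : ∀ s, |φ s| ≤ L * |s|)
    (hv : Integrable v μ) (hv2 : Integrable (fun x => v x ^ 2) μ) :
    ∫ x in E, φ (v x) * ∫ y, P x y * (v y - v x) ∂μ ∂μ
      ≤ M * (L * ∫ x, |v x| ∂μ) * ∫ x in Eᶜ, |v x| ∂μ := by
  have hint := integrable_kernel_mul_diff hPm hP0 hPM hPi hE hPK hφ hφL hv hv2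
  have hφv : AEStronglyMeasurable (fun x => φ (v x)) μ :=
    (hφ.measurable.comp_aemeasurable hv.aemeasurable).aestronglyMeasurable
  have hφvi : Integrable (fun x => φ (v x)) μ := by
    refine (hv.norm.const_mul L).mono' hφv (Eventually.of_forall fun x => ?_)
    simpa using hφL (v x)
  have hφ0 : φ 0 = 0 := by simpa using hφL 0
  have hφs : ∀ s, 0 ≤ φ s * s := fun s => by
    rcases le_total 0 s with hs | hs
    · exact mul_nonneg (hφ0 ▸ hφ hs) hs
    · exact mul_nonneg_of_nonpos_of_nonpos (hφ0 ▸ hφ hs) hs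
  have e1 : ∫ x in E, φ (v x) * ∫ y, P x y * (v y - v x) ∂μ ∂μ
      = ∫ z, P z.1 z.2 * (φ (v z.1) * (v z.2 - v z.1)) ∂((μ.restrict E).prod μ) := by
    rw [integral_prod _ hint]
    congr 1 with x
    rw [← integral_const_mul]
    congr 1 with y
    ring
  have hsplit : (μ.restrict E).prod μ
      = (μ.restrict E).prod (μ.restrict E) + (μ.restrict E).prod (μ.restrict Eᶜ) := by
    rw [← Measure.prod_add, Measure.restrict_add_restrict_compl hE]
  rw [hsplit] at hint
  have hi1 := hint.left_of_add_measure
  have hi2 := hint.right_of_add_measure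
  rw [e1, hsplit, integral_add_measure hi1 hi2]
  have hneg : ∫ z, P z.1 z.2 * (φ (v z.1) * (v z.2 - v z.1))
      ∂((μ.restrict E).prod (μ.restrict E)) ≤ 0 := by
    set I := ∫ z, P z.1 z.2 * (φ (v z.1) * (v z.2 - v z.1))
      ∂((μ.restrict E).prod (μ.restrict E)) with hI
    have hsw := integral_prod_swap (μ := μ.restrict E) (ν := μ.restrict E)
      (fun z : X × X => P z.1 z.2 * (φ (v z.1) * (v z.2 - v z.1)))
    have h2 : I + I ≤ 0 := by
      nth_rewrite 2 [hI]
      have hi1' : Integrable (fun z : X × X => P z.swap.1 z.swap.2 *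
          (φ (v z.swap.1) * (v z.swap.2 - v z.swap.1)))
          ((μ.restrict E).prod (μ.restrict E)) := hi1.swap
      rw [← hsw, hI, ← integral_add hi1 hi1']
      refine integral_nonpos fun z => ?_
      simp only [Prod.fst_swap, Prod.snd_swap, Pi.zero_apply]
      rw [hPs z.2 z.1]
      have : 0 ≤ P z.1 z.2 * ((φ (v z.1) - φ (v z.2)) * (v z.1 - v z.2)) := by
        refine mul_nonneg (hP0 _ _) ?_
        rcases le_total (v z.1) (v z.2) with h | h
        · exact mul_nonneg_of_nonpos_of_nonpos (sub_nonpos.2 (hφ h)) (sub_nonpos.2 h)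
        · exact mul_nonneg (sub_nonneg.2 (hφ h)) (sub_nonneg.2 h)
      linarith
    linarith
  have hpos : ∫ z, P z.1 z.2 * (φ (v z.1) * (v z.2 - v z.1))
      ∂((μ.restrict E).prod (μ.restrict Eᶜ))
      ≤ M * (L * ∫ x, |v x| ∂μ) * ∫ x in Eᶜ, |v x| ∂μ := by
    have hM : ∀ x y : X, 0 ≤ M := fun x y => (hP0 x y).trans (hPM x y)
    calc _ ≤ ∫ z : X × X, M * (|φ (v z.1)| * |v z.2|)
              ∂((μ.restrict E).prod (μ.restrict Eᶜ)) := by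
          refine integral_mono hi2 ((hφvi.restrict.abs.mul_prod hv.restrict.abs).const_mul M) ?_
          intro z
          simp only
          have h1 : φ (v z.1) * (v z.2 - v z.1) ≤ |φ (v z.1)| * |v z.2| := by
            rw [← abs_mul]
            have := hφs (v z.1)
            have := le_abs_self (φ (v z.1) * v z.2)
            linarith
          calc _ ≤ P z.1 z.2 * (|φ (v z.1)| * |v z.2|) :=
                mul_le_mul_of_nonneg_left h1 (hP0 _ _)
            _ ≤ _ := mul_le_mul_of_nonneg_right (hPM _ _) (by positivity)
      _ = M * ((∫ x in E, |φ (v x)| ∂μ) * ∫ x in Eᶜ, |v x| ∂μ) := by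
          rw [integral_const_mul, integral_prod_mul (fun x => |φ (v x)|) (fun x => |v x|)]
      _ ≤ _ := by
          rcases isEmpty_or_nonempty X with hX | ⟨⟨x0⟩⟩
          · simp [Measure.eq_zero_of_isEmpty]
          rw [mul_assoc]
          refine mul_le_mul_of_nonneg_left ?_ (hM x0 x0)
          refine mul_le_mul_of_nonneg_right ?_ (integral_nonneg fun _ => abs_nonneg _)
          rw [← integral_const_mul]
          calc ∫ x in E, |φ (v x)| ∂μ ≤ ∫ x, |φ (v x)| ∂μ :=
                setIntegral_le_integral hφvi.abs (Eventually.of_forall fun _ => abs_nonneg _)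
            _ ≤ _ := integral_mono hφvi.abs (hv.abs.const_mul L) fun x => hφL _
  linarith

/-! ### Dissipation on a translation-invariant band -/

/-- If the kernel dominates `h` on the translation-invariant band `{x - y ∈ S}`, then the form is
bounded by the dissipation `-h|S| ∫_E φ(v) v` of the loss term of that band, up to a gain term
and an error due to the mass of `v` outside `E`. -/
theorem setIntegral_kernel_diff_le_of_band {X : Type*} [AddCommGroup X] [MeasurableSpace X]
    [MeasurableAdd₂ X] [MeasurableNeg X] {μ : Measure X} [SFinite μ]
    [μ.IsAddLeftInvariant] [μ.IsNegInvariant]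
    {J : X → X → ℝ} {M K L h α β : ℝ} {φ : ℝ → ℝ} {v : X → ℝ} {E S : Set X}
    (hJm : Measurable (Function.uncurry J)) (hJ0 : ∀ x y, 0 ≤ J x y) (hJM : ∀ x y, J x y ≤ M)
    (hJs : ∀ x y, J x y = J y x) (hJi : ∀ x, Integrable (J x) μ)
    (hE : MeasurableSet E) (hJK : ∀ x ∈ E, ∫ y, J x y ∂μ ≤ K)
    (hS : MeasurableSet S) (hSf : μ S ≠ ∞) (hSs : ∀ z, -z ∈ S ↔ z ∈ S) (hh : 0 ≤ h)
    (hJS : ∀ x y, x - y ∈ S → h ≤ J x y)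
    (hφ : Monotone φ) (hφL : ∀ s, |φ s| ≤ L * |s|)
    (hα : 0 ≤ α) (hβ : 0 ≤ β) (hφαβ : ∀ s, |φ s| ≤ α + β * |s|)
    (hv : Integrable v μ) (hv2 : Integrable (fun x => v x ^ 2) μ) :
    ∫ x in E, φ (v x) * ∫ y, J x y * (v y - v x) ∂μ ∂μ
      ≤ -(h * μ.real S) * (∫ x in E, φ (v x) * v x ∂μ)
        + h * (α * μ.real S * (∫ x, |v x| ∂μ) + β * (∫ x, |v x| ∂μ) ^ 2)
        + M * (L * ∫ x, |v x| ∂μ) * ∫ x in Eᶜ, |v x| ∂μ := by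
  set k : X → ℝ := S.indicator (fun _ => h) with hk
  set m := ∫ x, |v x| ∂μ with hm
  have hm0 : 0 ≤ m := integral_nonneg fun _ => abs_nonneg _
  have hkm : Measurable k := measurable_const.indicator hS
  have hk0 : ∀ z, 0 ≤ k z := fun z => Set.indicator_nonneg (fun _ _ => hh) z
  have hkh : ∀ z, k z ≤ h := fun z => Set.indicator_le_self' (fun _ _ => hh) z
  have hki : Integrable k μ := (integrable_indicator_iff hS).2 (integrableOn_const hSf)
  have hks : ∀ z, k (-z) = k z := fun z => by
    by_cases hz : z ∈ S
    · simp [hk, hz, (hSs z).2 hz]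
    · simp [hk, hz, mt (hSs z).1 hz]
  have hkint : ∫ z, k z ∂μ = h * μ.real S := by
    rw [hk, integral_indicator hS, setIntegral_const, smul_eq_mul, mul_comm]
  have hkJ : ∀ x y, k (x - y) ≤ J x y := fun x y => by
    by_cases hz : x - y ∈ S
    · simpa [hk, hz] using hJS x y hz
    · simpa [hk, hz] using hJ0 x y
  have hkxi : ∀ x, Integrable (fun y => k (x - y)) μ := fun x => hki.comp_sub_left x
  have hkxint : ∀ x, ∫ y, k (x - y) ∂μ = h * μ.real S := fun x => by
    rw [integral_sub_left_eq_self, hkint]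
  have hφv : AEStronglyMeasurable (fun x => φ (v x)) μ :=
    (hφ.measurable.comp_aemeasurable hv.aemeasurable).aestronglyMeasurable
  -- the part of the kernel above the band
  have hA := setIntegral_kernel_diff_le (μ := μ) (P := fun x y => J x y - k (x - y)) (M := M)
    (K := K) (L := L) (φ := φ) (v := v) (E := E)
    (hJm.sub (hkm.comp (measurable_fst.sub measurable_snd)))
    (fun x y => sub_nonneg.2 (hkJ x y))
    (fun x y => by have := hk0 (x - y); have := hJM x y; linarith)
    (fun x y => by rw [hJs x y, ← hks (x - y), neg_sub])
    (fun x => (hJi x).sub (hkxi x)) hE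
    (fun x hx => by
      rw [integral_sub (hJi x) (hkxi x), hkxint]
      have := hJK x hx
      have : 0 ≤ h * μ.real S := by positivity
      linarith) hφ hφL hv hv2
  have hkv : ∀ x, Integrable (fun y => k (x - y) * v y) μ := fun x =>
    hv.bdd_mul (c := h) (hkxi x).aestronglyMeasurable (Eventually.of_forall fun y => by
      rw [Real.norm_of_nonneg (hk0 _)]; exact hkh _)
  have hJv : ∀ x, Integrable (fun y => J x y * v y) μ := fun x =>
    hv.bdd_mul (c := M) (hJi x).aestronglyMeasurable (Eventually.of_forall fun y => by
      rw [Real.norm_of_nonneg (hJ0 _ _)]; exact hJM _ _)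
  have hJd : ∀ x, Integrable (fun y => J x y * (v y - v x)) μ := fun x => by
    simp only [mul_sub]; exact (hJv x).sub ((hJi x).mul_const (v x))
  have hkd : ∀ x, Integrable (fun y => k (x - y) * (v y - v x)) μ := fun x => by
    simp only [mul_sub]; exact (hkv x).sub ((hkxi x).mul_const (v x))
  have hPd : ∀ x, φ (v x) * ∫ y, (J x y - k (x - y)) * (v y - v x) ∂μ
      = φ (v x) * (∫ y, J x y * (v y - v x) ∂μ) - φ (v x) * ∫ y, k (x - y) * v y ∂μ
        + h * μ.real S * (φ (v x) * v x) := fun x => by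
    have : ∫ y, (J x y - k (x - y)) * (v y - v x) ∂μ
        = (∫ y, J x y * (v y - v x) ∂μ) - ((∫ y, k (x - y) * v y ∂μ) - h * μ.real S * v x) := by
      have h1 : ∫ y, k (x - y) * (v y - v x) ∂μ
          = (∫ y, k (x - y) * v y ∂μ) - h * μ.real S * v x := by
        simp only [mul_sub]
        rw [← hkxint x, ← integral_mul_const]
        exact integral_sub (hkv x) ((hkxi x).mul_const (v x))
      simp only [sub_mul]
      rw [← h1]
      exact integral_sub (hJd x) (hkd x)
    rw [this]; ring
  -- integrability of the three pieces
  have hφvv : Integrable (fun x => φ (v x) * v x) μ := by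
    refine (hv2.const_mul L).mono' (hφv.mul hv.aestronglyMeasurable)
      (Eventually.of_forall fun x => ?_)
    rw [norm_mul, Real.norm_eq_abs, Real.norm_eq_abs]
    calc |φ (v x)| * |v x| ≤ (L * |v x|) * |v x| := by gcongr; exact hφL _
      _ = L * v x ^ 2 := by rw [← sq_abs (v x)]; ring
  have hIJ : IntegrableOn (fun x => φ (v x) * ∫ y, J x y * (v y - v x) ∂μ) E μ :=
    integrableOn_mul_integral_kernel_diff hJm hJ0 hJM hJi hE hJK hφ hφL hv hv2
  have hconv : Integrable (fun z : X × X => k (z.1 - z.2) * |v z.2|) (μ.prod μ) := by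
    have h1 : Integrable (fun z : X × X => k z.1 * |v z.2|) (μ.prod μ) := hki.mul_prod hv.abs
    have hmp : MeasurePreserving (fun z : X × X => (z.2, z.1 - z.2)) (μ.prod μ) (μ.prod μ) :=
      measurePreserving_prod_sub_swap μ μ
    have h2 := hmp.integrable_comp_of_integrable (hv.abs.mul_prod hki)
    refine h2.congr (Eventually.of_forall fun z => ?_)
    simp [mul_comm]
  set g : X → ℝ := fun x => ∫ y, k (x - y) * |v y| ∂μ with hg
  have hgi : Integrable g μ := hconv.integral_prod_left
  have hkva : ∀ x, Integrable (fun y => k (x - y) * |v y|) μ := fun x =>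
    hv.abs.bdd_mul (c := h) (hkxi x).aestronglyMeasurable (Eventually.of_forall fun y => by
      rw [Real.norm_of_nonneg (hk0 _)]; exact hkh _)
  have hg0 : ∀ x, 0 ≤ g x := fun x =>
    integral_nonneg fun y => mul_nonneg (hk0 _) (abs_nonneg _)
  have hgm : ∀ x, g x ≤ h * m := fun x => by
    rw [hm, ← integral_const_mul]
    exact integral_mono (hkva x) (hv.abs.const_mul h) fun y =>
      mul_le_mul_of_nonneg_right (hkh _) (abs_nonneg _)
  have hgint : ∫ x, g x ∂μ = h * μ.real S * m := by
    rw [hg, integral_integral_swap hconv]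
    simp only [integral_mul_const]
    have : ∀ y, ∫ x, k (x - y) ∂μ = h * μ.real S := fun y => by
      simp_rw [← hks (_ - y), neg_sub]
      exact hkxint y
    simp only [this, integral_const_mul, hm]
  have habs : ∀ x, ‖φ (v x) * ∫ y, k (x - y) * v y ∂μ‖ ≤ α * g x + β * (h * m) * |v x| := by
    intro x
    have h1 : |∫ y, k (x - y) * v y ∂μ| ≤ g x := by
      refine abs_integral_le_integral_abs.trans_eq ?_
      congr 1 with y
      rw [abs_mul, abs_of_nonneg (hk0 _)]
    rw [norm_mul, Real.norm_eq_abs, Real.norm_eq_abs]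
    calc |φ (v x)| * |∫ y, k (x - y) * v y ∂μ| ≤ (α + β * |v x|) * g x := by
          gcongr; exact hφαβ _
      _ = α * g x + β * g x * |v x| := by ring
      _ ≤ _ := by gcongr; exact hgm x
  have hkm2 : AEStronglyMeasurable (fun x => ∫ y, k (x - y) * v y ∂μ) μ := by
    refine AEStronglyMeasurable.integral_prod_right' (f := fun z : X × X => k (z.1 - z.2) * v z.2) ?_
    exact (hkm.comp (measurable_fst.sub measurable_snd)).aestronglyMeasurable.mul
      hv.aestronglyMeasurable.comp_snd
  have hdom : Integrable (fun x => α * g x + β * (h * m) * |v x|) μ :=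
    (hgi.const_mul α).add (hv.abs.const_mul _)
  have hIk : Integrable (fun x => φ (v x) * ∫ y, k (x - y) * v y ∂μ) μ :=
    hdom.mono' (hφv.mul hkm2) (Eventually.of_forall habs)
  have hgain : ∫ x in E, φ (v x) * ∫ y, k (x - y) * v y ∂μ ∂μ
      ≤ h * (α * μ.real S * m + β * m ^ 2) := by
    calc _ ≤ ∫ x in E, (α * g x + β * (h * m) * |v x|) ∂μ :=
          integral_mono hIk.restrict hdom.restrict fun x => (le_abs_self _).trans (habs x)
      _ ≤ ∫ x, (α * g x + β * (h * m) * |v x|) ∂μ :=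
          setIntegral_le_integral hdom (Eventually.of_forall fun x => by
            have := hg0 x
            simp only [Pi.zero_apply]; positivity)
      _ = _ := by
          rw [integral_add (hgi.const_mul α) (hv.abs.const_mul _), integral_const_mul,
            integral_const_mul, hgint, ← hm]
          ring
  simp only [hPd] at hA
  have hIJk : IntegrableOn (fun x => φ (v x) * (∫ y, J x y * (v y - v x) ∂μ)
      - φ (v x) * ∫ y, k (x - y) * v y ∂μ) E μ := hIJ.sub hIk.restrict
  rw [integral_add hIJk (hφvv.restrict.const_mul _),
    integral_sub hIJ hIk.restrict, integral_const_mul] at hA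
  linarith

/-! ### Regularized powers -/

/-- A smooth even convex approximation `((s² + d²)^{q/2} - d^q) / q` of `|s|^q / q`, which is
quadratic near the origin; `d^q` is written `(d²)^{q/2}`, so that the value at `0` is `0`. -/
noncomputable def regPow (q d s : ℝ) : ℝ := ((s ^ 2 + d ^ 2) ^ (q / 2) - (d ^ 2) ^ (q / 2)) / q

/-- The derivative `s (s² + d²)^{q/2 - 1}` of `regPow q d`. -/
noncomputable def regPowDeriv (q d s : ℝ) : ℝ := s * (s ^ 2 + d ^ 2) ^ (q / 2 - 1)

section regPow

variable {q d : ℝ}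

theorem hasDerivAt_regPow (hq : q ≠ 0) (hd : 0 < d) (s : ℝ) :
    HasDerivAt (regPow q d) (regPowDeriv q d s) s := by
  have hpos : 0 < s ^ 2 + d ^ 2 := by positivity
  have h := ((((hasDerivAt_id s).pow 2).add_const (d ^ 2)).rpow_const (p := q / 2)
    (Or.inl hpos.ne')).sub_const ((d ^ 2) ^ (q / 2)) |>.div_const q
  refine h.congr_deriv ?_
  simp only [regPowDeriv, id, Pi.pow_apply]
  field_simp
  push_cast
  ring

theorem monotone_regPowDeriv (hq : 1 ≤ q) (hd : 0 < d) : Monotone (regPowDeriv q d) := by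
  have hder : ∀ s, HasDerivAt (regPowDeriv q d)
      ((s ^ 2 + d ^ 2) ^ (q / 2 - 1 - 1) * ((q - 1) * s ^ 2 + d ^ 2)) s := fun s => by
    have hpos : 0 < s ^ 2 + d ^ 2 := by positivity
    have h := (hasDerivAt_id s).mul ((((hasDerivAt_id s).pow 2).add_const (d ^ 2)).rpow_const
      (p := q / 2 - 1) (Or.inl hpos.ne'))
    refine h.congr_deriv ?_
    simp only [id, Pi.pow_apply]
    rw [Real.rpow_sub_one hpos.ne' (q / 2 - 1)]
    field_simp
    push_cast
    ring
  refine monotone_of_deriv_nonneg (fun s => (hder s).differentiableAt) fun s => ?_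
  rw [(hder s).deriv]
  have : 0 ≤ q - 1 := by linarith
  positivity

theorem abs_regPowDeriv_le_linear (hq : q ≤ 2) (hd : 0 < d) (s : ℝ) :
    |regPowDeriv q d s| ≤ (d ^ 2) ^ (q / 2 - 1) * |s| := by
  rw [regPowDeriv, abs_mul, mul_comm, abs_of_nonneg (by positivity)]
  refine mul_le_mul_of_nonneg_right ?_ (abs_nonneg s)
  exact Real.rpow_le_rpow_of_nonpos (by positivity) (by nlinarith) (by linarith)

theorem abs_regPowDeriv_le_rpow (hq : q ≤ 2) (s : ℝ) (hs : s ≠ 0) :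
    |regPowDeriv q d s| ≤ |s| ^ (q - 2) * |s| := by
  have hs' : 0 < |s| := abs_pos.2 hs
  rw [regPowDeriv, abs_mul, mul_comm, abs_of_nonneg (by positivity)]
  gcongr
  have : |s| ^ (q - 2) = (s ^ 2) ^ (q / 2 - 1) := by
    rw [← sq_abs, ← Real.rpow_natCast, ← Real.rpow_mul hs'.le]
    congr 1
    push_cast
    ring
  rw [this]
  exact Real.rpow_le_rpow_of_nonpos (by positivity) (by nlinarith [sq_nonneg d]) (by linarith)

theorem abs_regPowDeriv_le_affine (hq1 : 1 ≤ q) (hq : q ≤ 2) {l : ℝ} (hl : 0 < l) (s : ℝ) :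
    |regPowDeriv q d s| ≤ l ^ (q - 1) + l ^ (q - 2) * |s| := by
  rcases eq_or_ne s 0 with rfl | hs
  · simp only [regPowDeriv, zero_mul, abs_zero, mul_zero, add_zero]
    positivity
  have hs' : 0 < |s| := abs_pos.2 hs
  refine (abs_regPowDeriv_le_rpow hq s hs).trans ?_
  rcases le_total |s| l with h | h
  · have h1 : |s| ^ (q - 2) * |s| = |s| ^ (q - 1) := by
      rw [← Real.rpow_add_one hs'.ne']; congr 1; ring
    have h2 : |s| ^ (q - 1) ≤ l ^ (q - 1) := Real.rpow_le_rpow hs'.le h (by linarith)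
    have : 0 ≤ l ^ (q - 2) * |s| := by positivity
    linarith
  · have h2 : |s| ^ (q - 2) ≤ l ^ (q - 2) := Real.rpow_le_rpow_of_nonpos hl h (by linarith)
    have h3 := mul_le_mul_of_nonneg_right h2 hs'.le
    have : 0 ≤ l ^ (q - 1) := by positivity
    linarith

theorem regPow_nonneg (hq : 0 < q) (s : ℝ) : 0 ≤ regPow q d s := by
  refine div_nonneg (sub_nonneg.2 ?_) hq.le
  exact Real.rpow_le_rpow (by positivity) (by nlinarith [sq_nonneg s]) (by positivity)

theorem regPow_le_deriv_mul (hq : 1 ≤ q) (hd : 0 < d) (s : ℝ) :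
    regPow q d s ≤ regPowDeriv q d s * s := by
  have hq0 : q ≠ 0 := by linarith
  have hmono := monotone_regPowDeriv hq hd
  have h0 : regPow q d 0 = 0 := by simp [regPow]
  have hconv : ConvexOn ℝ Set.univ (regPow q d) := by
    refine MonotoneOn.convexOn_of_deriv convex_univ
      (fun x _ => (hasDerivAt_regPow hq0 hd x).continuousAt.continuousWithinAt)
      (fun x _ => (hasDerivAt_regPow hq0 hd x).differentiableAt.differentiableWithinAt) ?_
    intro x _ y _ hxy
    rw [(hasDerivAt_regPow hq0 hd x).deriv, (hasDerivAt_regPow hq0 hd y).deriv]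
    exact hmono hxy
  rcases lt_trichotomy s 0 with hs | rfl | hs
  · have := hconv.le_slope_of_hasDerivAt (Set.mem_univ s) (Set.mem_univ 0) hs
      (hasDerivAt_regPow hq0 hd s)
    rw [slope_def_field, h0, zero_sub, zero_sub, le_div_iff₀ (by linarith)] at this
    linarith
  · simp [h0]
  · have := hconv.slope_le_of_hasDerivAt (Set.mem_univ 0) (Set.mem_univ s) hs
      (hasDerivAt_regPow hq0 hd s)
    rw [slope_def_field, h0, sub_zero, sub_zero, div_le_iff₀ hs] at this
    exact this

theorem regPow_le_rpow (hq1 : 1 ≤ q) (hq : q ≤ 2) (hd : 0 < d) (s : ℝ) :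
    regPow q d s ≤ |s| ^ q := by
  rcases eq_or_ne s 0 with rfl | hs
  · have : regPow q d 0 = 0 := by simp [regPow]
    rw [this]; positivity
  have hs' : 0 < |s| := abs_pos.2 hs
  calc regPow q d s ≤ regPowDeriv q d s * s := regPow_le_deriv_mul hq1 hd s
    _ ≤ |regPowDeriv q d s| * |s| := by rw [← abs_mul]; exact le_abs_self _
    _ ≤ |s| ^ (q - 2) * |s| * |s| := by gcongr; exact abs_regPowDeriv_le_rpow hq s hs
    _ = |s| ^ q := by
      rw [← Real.rpow_add_one hs'.ne', ← Real.rpow_add_one hs'.ne']; congr 1; ring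

theorem tendsto_regPow (hq : 0 < q) (s : ℝ) :
    Tendsto (fun d => regPow q d s) (𝓝[>] 0) (𝓝 (|s| ^ q / q)) := by
  have h : Continuous fun d => regPow q d s := by
    unfold regPow
    refine Continuous.div_const (Continuous.sub ?_ ?_) _
    · exact Continuous.rpow_const (by fun_prop) fun x => Or.inr (by positivity)
    · exact Continuous.rpow_const (by fun_prop) fun x => Or.inr (by positivity)
  have h0 : regPow q 0 s = |s| ^ q / q := by
    have : q / 2 ≠ 0 := by positivity
    rw [regPow]
    norm_num [Real.zero_rpow this]
    rw [← sq_abs s, ← Real.rpow_natCast |s|, ← Real.rpow_mul (abs_nonneg s)]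
    congr 2
    push_cast
    ring
  rw [← h0]
  exact (h.tendsto 0).mono_left nhdsWithin_le_nhds

end regPow

/-! ### Integrability and time derivative of truncated functionals -/

theorem integrable_abs_rpow_of_memLp {X : Type*} [MeasurableSpace X] {μ : Measure X} {f : X → ℝ}
    {p : ℝ} (hp : 1 ≤ p) (h1 : MemLp f 1 μ) (h2 : MemLp f ∞ μ) :
    Integrable (fun x => |f x| ^ p) μ := by
  have hf := memLp_one_iff_integrable.1 h1
  have hm : AEStronglyMeasurable (fun x => |f x| ^ (p - 1)) μ :=
    (hf.aemeasurable.abs.pow_const _).aestronglyMeasurable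
  have hb : ∀ᵐ x ∂μ, ‖|f x| ^ (p - 1)‖ ≤ (eLpNorm f ∞ μ).toReal ^ (p - 1) := by
    filter_upwards [ae_le_eLpNormEssSup (f := f) (μ := μ)] with x hx
    rw [← eLpNorm_exponent_top, ← ofReal_norm] at hx
    have hx' := (ENNReal.ofReal_le_iff_le_toReal h2.2.ne).1 hx
    rw [Real.norm_of_nonneg (by positivity)]
    exact Real.rpow_le_rpow (abs_nonneg _) hx' (by linarith)
  refine (hf.abs.bdd_mul hm hb).congr (Eventually.of_forall fun x => ?_)
  simp only
  rw [← Real.rpow_add_one' (abs_nonneg _) (by linarith), sub_add_cancel]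

theorem eLpNorm_ofReal_eq_integral {X : Type*} [MeasurableSpace X] {μ : Measure X} {f : X → ℝ}
    {q : ℝ} (hq : 1 ≤ q) (h1 : MemLp f 1 μ) (h2 : MemLp f ∞ μ) :
    eLpNorm f (ENNReal.ofReal q) μ = ENNReal.ofReal ((∫ x, |f x| ^ q ∂μ) ^ (1 / q)) := by
  have hq0 : 0 < q := by linarith
  have hi := integrable_abs_rpow_of_memLp hq h1 h2
  rw [eLpNorm_eq_lintegral_rpow_enorm_toReal (by simpa using hq0) (by simp),
    ENNReal.toReal_ofReal hq0.le,
    ← ENNReal.ofReal_rpow_of_nonneg (integral_nonneg fun _ => by positivity) (by positivity),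
    ofReal_integral_eq_lintegral_ofReal hi (Eventually.of_forall fun _ => by positivity)]
  congr 2 with x
  rw [← ofReal_norm, ENNReal.ofReal_rpow_of_nonneg (norm_nonneg _) hq0.le, Real.norm_eq_abs]

/-- A differential inequality `F' ≤ -a F + c` with a possibly vanishing rate `a ≥ 0`. -/
theorem le_exp_mul_add_of_deriv_le {F F' : ℝ → ℝ} {a c s t : ℝ} (ha : 0 ≤ a) (hc : 0 ≤ c)
    (hst : s ≤ t) (hF : ∀ τ ∈ Set.Icc s t, HasDerivAt F (F' τ) τ)
    (hle : ∀ τ ∈ Set.Icc s t, F' τ ≤ -a * F τ + c) :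
    F t ≤ Real.exp (-(a * (t - s))) * F s + (t - s) * c := by
  have hd : ∀ τ ∈ Set.Icc s t, HasDerivAt (fun τ => Real.exp (a * (τ - t)) * F τ - c * τ)
      (Real.exp (a * (τ - t)) * (F' τ + a * F τ) - c) τ := fun τ hτ => by
    have h1 : HasDerivAt (fun τ => Real.exp (a * (τ - t))) (Real.exp (a * (τ - t)) * a) τ := by
      simpa using (((hasDerivAt_id τ).sub_const t).const_mul a).exp
    refine ((h1.mul (hF τ hτ)).sub ((hasDerivAt_id τ).const_mul c)).congr_deriv ?_
    ring
  have hanti : AntitoneOn (fun τ => Real.exp (a * (τ - t)) * F τ - c * τ) (Set.Icc s t) := by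
    refine antitoneOn_of_deriv_nonpos (convex_Icc s t)
      (fun τ hτ => (hd τ hτ).continuousAt.continuousWithinAt)
      (fun τ hτ => (hd τ (interior_subset hτ)).differentiableAt.differentiableWithinAt) ?_
    intro τ hτ
    have hτ := interior_subset hτ
    rw [(hd τ hτ).deriv]
    have h1 : F' τ + a * F τ ≤ c := by linarith [hle τ hτ]
    have h2 : Real.exp (a * (τ - t)) ≤ 1 :=
      Real.exp_le_one_iff.2 (mul_nonpos_of_nonneg_of_nonpos ha (by linarith [hτ.2]))
    have h3 := mul_le_mul_of_nonneg_left h1 (Real.exp_pos (a * (τ - t))).le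
    nlinarith
  have := hanti (Set.left_mem_Icc.2 hst) (Set.right_mem_Icc.2 hst) hst
  simp only [sub_self, mul_zero, Real.exp_zero, one_mul] at this
  have e : -(a * (t - s)) = a * (s - t) := by ring
  rw [e]
  linarith

section Solution

variable {n : ℕ} {J : EuclideanSpace ℝ (Fin n) → EuclideanSpace ℝ (Fin n) → ℝ}
  {u₀ : EuclideanSpace ℝ (Fin n) → ℝ} {u : ℝ → EuclideanSpace ℝ (Fin n) → ℝ} {σ c₁ c₂ : ℝ}

theorem IsFatTailKernel.integrable_right (hJ : IsFatTailKernel n σ c₁ c₂ J)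
    (x : EuclideanSpace ℝ (Fin n)) : Integrable (J x) volume := by
  refine (hJ.integrable x).congr (Eventually.of_forall fun y => hJ.symm y x)

theorem IsNonlocalHeatSolution.integrable (hu : IsNonlocalHeatSolution J u₀ u) {t : ℝ}
    (ht : 0 ≤ t) : Integrable (u t) volume := memLp_one_iff_integrable.1 (hu.memLp_one t ht)

theorem IsNonlocalHeatSolution.integrable_sq (hu : IsNonlocalHeatSolution J u₀ u) {t : ℝ}
    (ht : 0 ≤ t) : Integrable (fun x => u t x ^ 2) volume := by
  have := integrable_abs_rpow_of_memLp (p := 2) (by norm_num) (hu.memLp_one t ht)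
    (hu.memLp_top t ht)
  simpa using this

theorem IsNonlocalHeatSolution.continuousOn_setIntegral_abs
    (hu : IsNonlocalHeatSolution J u₀ u) (E : Set (EuclideanSpace ℝ (Fin n))) :
    ContinuousOn (fun t => ∫ x in E, |u t x|) (Set.Ici 0) := by
  intro t ht
  have ht : 0 ≤ t := ht
  rw [ContinuousWithinAt, tendsto_iff_norm_sub_tendsto_zero]
  have h1 : Tendsto (fun s => (eLpNorm (u s - u t) 1 volume).toReal) (𝓝[Set.Ici 0] t) (𝓝 0) := by
    exact (ENNReal.tendsto_toReal ENNReal.zero_ne_top).comp (hu.continuous_one t ht)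
  refine squeeze_zero' (Eventually.of_forall fun _ => norm_nonneg _) ?_ h1
  filter_upwards [self_mem_nhdsWithin] with s hs
  have hs : 0 ≤ s := hs
  have hd := (hu.integrable hs).sub (hu.integrable ht)
  rw [← integral_sub (hu.integrable hs).abs.restrict (hu.integrable ht).abs.restrict]
  calc ‖∫ x in E, (|u s x| - |u t x|)‖ ≤ ∫ x in E, ‖|u s x| - |u t x|‖ :=
        norm_integral_le_integral_norm _
    _ ≤ ∫ x in E, ‖(u s - u t) x‖ :=
        integral_mono ((hu.integrable hs).abs.sub (hu.integrable ht).abs).norm.restrict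
          hd.norm.restrict fun x => abs_abs_sub_abs_le_abs_sub _ _
    _ ≤ ∫ x, ‖(u s - u t) x‖ :=
        setIntegral_le_integral hd.norm (Eventually.of_forall fun _ => norm_nonneg _)
    _ = _ := by rw [eLpNorm_one_eq_lintegral_enorm, integral_norm_eq_lintegral_enorm hd.1]

theorem IsNonlocalHeatSolution.exists_ae_bound (hu : IsNonlocalHeatSolution J u₀ u) {t : ℝ}
    (ht : 0 < t) : ∃ ε > 0, ∃ B ≥ 0, ε < t ∧ ∀ᵐ x, ∀ s ∈ Metric.ball t ε, |u s x| ≤ B := by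
  have h1 : ∀ᶠ s in 𝓝[Set.Ici 0] t, eLpNorm (u s - u t) ∞ volume < 1 :=
    (hu.continuous_top t ht.le).eventually_lt_const (by simp)
  rw [nhdsWithin_eq_nhds.2 (Ici_mem_nhds ht)] at h1
  obtain ⟨ε, hε, h2⟩ := Metric.eventually_nhds_iff_ball.1 (h1.and (eventually_gt_nhds ht))
  refine ⟨min ε (t / 2), by positivity, (eLpNorm (u t) ∞ volume).toReal + 1, by positivity,
    (min_le_right _ _).trans_lt (by linarith), ?_⟩
  have hball : Metric.ball t (min ε (t / 2)) ⊆ Metric.ball t ε :=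
    Metric.ball_subset_ball (min_le_left _ _)
  -- the bound holds off a common null set for rational times, and passes to all times by continuity
  have hrat : ∀ᵐ x, ∀ r : ℚ, (r : ℝ) ∈ Metric.ball t (min ε (t / 2)) →
      |u r x| ≤ (eLpNorm (u t) ∞ volume).toReal + 1 := by
    rw [ae_all_iff]
    intro r
    by_cases hr : (r : ℝ) ∈ Metric.ball t (min ε (t / 2))
    · have hr' := h2 r (hball hr)
      have ha := ae_le_eLpNormEssSup (f := u r - u t) (μ := volume)
      have hb := ae_le_eLpNormEssSup (f := u t) (μ := volume)
      filter_upwards [ha, hb] with x hxa hxb _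
      rw [← eLpNorm_exponent_top] at hxa hxb
      have hxa' : ‖(u r - u t) x‖ ≤ 1 := by
        have := hxa.trans hr'.1.le
        rw [← ofReal_norm, ← ENNReal.ofReal_one] at this
        exact (ENNReal.ofReal_le_ofReal_iff zero_le_one).1 this
      have hxb' : ‖u t x‖ ≤ (eLpNorm (u t) ∞ volume).toReal := by
        rw [← ofReal_norm] at hxb
        exact (ENNReal.ofReal_le_iff_le_toReal (hu.memLp_top t ht.le).2.ne).1 hxb
      calc |u r x| = ‖u t x + (u r - u t) x‖ := by simp
        _ ≤ _ := (norm_add_le _ _).trans (add_le_add hxb' hxa')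
    · exact Eventually.of_forall fun x h => absurd h hr
  filter_upwards [hrat, hu.equation] with x hx hex s hs
  by_contra! hlt
  have hc : ContinuousAt (fun s => |u s x|) s := (hex s (h2 s (hball hs)).2).continuousAt.abs
  have hev := (hc.eventually_const_lt hlt).and (Metric.isOpen_ball.mem_nhds hs)
  obtain ⟨O, hO, hOo, hsO⟩ := mem_nhds_iff.1 hev
  obtain ⟨r, hr⟩ := Rat.denseRange_cast.exists_mem_open hOo ⟨s, hsO⟩
  exact absurd (hx r (hO hr).2) (not_le.2 (hO hr).1)

theorem IsNonlocalHeatSolution.hasDerivAt_setIntegral (hJ : IsFatTailKernel n σ c₁ c₂ J)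
    (hu : IsNonlocalHeatSolution J u₀ u) {Φ φ : ℝ → ℝ} {K L : ℝ}
    {E : Set (EuclideanSpace ℝ (Fin n))} (hE : MeasurableSet E) (hEf : volume E ≠ ∞)
    (hJK : ∀ x ∈ E, ∫ y, J x y ≤ K) (hΦ : ∀ s, HasDerivAt Φ (φ s) s) (hΦ0 : ∀ s, 0 ≤ Φ s)
    (hΦφ : ∀ s, Φ s ≤ φ s * s) (hφ : Monotone φ) (hφL : ∀ s, |φ s| ≤ L * |s|) {t : ℝ}
    (ht : 0 < t) :
    HasDerivAt (fun τ => ∫ x in E, Φ (u τ x))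
      (∫ x in E, φ (u t x) * ∫ y, J x y * (u t y - u t x)) t := by
  obtain ⟨M, hM⟩ := hJ.bounded
  have hM0 : 0 ≤ M := (hJ.nonneg 0 0).trans (hM 0 0)
  have hL0 : 0 ≤ L := by simpa using (abs_nonneg _).trans (hφL 1)
  obtain ⟨ε, hε, B, hB, hεt, hbd⟩ := hu.exists_ae_bound ht
  have hΦc : Continuous Φ := continuous_iff_continuousAt.2 fun s => (hΦ s).continuousAt
  have hpos : ∀ s ∈ Metric.ball t ε, 0 < s := fun s hs => by
    rw [Metric.mem_ball, Real.dist_eq, abs_lt] at hs; linarith [hs.1]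
  have hmc : ∀ᶠ s in 𝓝 t, ∫ x, |u s x| < (∫ x, |u t x|) + 1 := by
    have := hu.continuousOn_setIntegral_abs Set.univ
    simp only [Measure.restrict_univ] at this
    exact (this.continuousAt (Ici_mem_nhds ht)).eventually_lt_const (by linarith)
  set m := (∫ x, |u t x|) + 1 with hm
  have hns : {s | s ∈ Metric.ball t ε ∧ ∫ x, |u s x| < m} ∈ 𝓝 t :=
    (Metric.ball_mem_nhds t hε |> fun h => (Filter.Eventually.and h hmc))
  refine (hasDerivAt_integral_of_dominated_loc_of_deriv_le
    (μ := volume.restrict E) (F := fun τ x => Φ (u τ x))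
    (F' := fun τ x => φ (u τ x) * ∫ y, J x y * (u τ y - u τ x))
    (bound := fun _ => L * B * (M * m + K * B)) hns ?_ ?_ ?_ ?_ ?_ ?_).2
  · filter_upwards [eventually_gt_nhds ht] with s hs
    exact (hΦc.comp_aestronglyMeasurable (hu.integrable hs.le).1).restrict
  · refine (((hu.integrable_sq ht.le).const_mul L).mono'
      (hΦc.comp_aestronglyMeasurable (hu.integrable ht.le).1)
      (Eventually.of_forall fun x => ?_)).restrict
    rw [Real.norm_of_nonneg (hΦ0 _)]
    calc Φ (u t x) ≤ φ (u t x) * u t x := hΦφ _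
      _ ≤ |φ (u t x)| * |u t x| := by rw [← abs_mul]; exact le_abs_self _
      _ ≤ (L * |u t x|) * |u t x| := by gcongr; exact hφL _
      _ = L * u t x ^ 2 := by rw [← sq_abs (u t x)]; ring
  · exact (integrableOn_mul_integral_kernel_diff hJ.continuous.measurable hJ.nonneg hM
      hJ.integrable_right hE hJK hφ hφL (hu.integrable ht.le) (hu.integrable_sq ht.le)).1
  · filter_upwards [ae_restrict_of_ae hbd, ae_restrict_mem hE] with x hx hxE s hs
    have hs0 := (hpos s hs.1).le
    have hux := hx s hs.1
    have hm0 : 0 ≤ m := (integral_nonneg fun _ => abs_nonneg _).trans hs.2.le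
    have hK0 : 0 ≤ K := (integral_nonneg (hJ.nonneg x)).trans (hJK x hxE)
    have hi1 : Integrable (fun y => M * |u s y|) volume := (hu.integrable hs0).abs.const_mul M
    have hi2 : Integrable (fun y => J x y * |u s x|) volume :=
      (hJ.integrable_right x).mul_const _
    have hint : |∫ y, J x y * (u s y - u s x)| ≤ M * m + K * B := by
      calc |∫ y, J x y * (u s y - u s x)| ≤ ∫ y, (M * |u s y| + J x y * |u s x|) := by
            refine norm_integral_le_of_norm_le (f := fun y => J x y * (u s y - u s x)) (hi1.add hi2) (Eventually.of_forall fun y => ?_)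
            rw [norm_mul, Real.norm_of_nonneg (hJ.nonneg x y)]
            have h1 : ‖u s y - u s x‖ ≤ |u s y| + |u s x| := norm_sub_le _ _
            have h2 := mul_le_mul_of_nonneg_left h1 (hJ.nonneg x y)
            have h3 := mul_le_mul_of_nonneg_right (hM x y) (abs_nonneg (u s y))
            linarith
        _ = M * (∫ y, |u s y|) + (∫ y, J x y) * |u s x| := by
            rw [integral_add hi1 hi2, integral_const_mul, integral_mul_const]
        _ ≤ M * m + K * B := by
            gcongr
            · exact hs.2.le
            · exact hJK x hxE
    rw [norm_mul]
    refine mul_le_mul ((hφL _).trans ?_) hint (norm_nonneg _) (by positivity)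
    gcongr
  · exact integrableOn_const hEf
  · filter_upwards [ae_restrict_of_ae hu.equation] with x hx s hs
    exact HasDerivAt.comp s (hΦ (u s x)) (hx s (hpos s hs.1))

end Solution

/-! ### Energy inequality and contraction of norms -/

section Solution

variable {n : ℕ} {J : EuclideanSpace ℝ (Fin n) → EuclideanSpace ℝ (Fin n) → ℝ}
  {u₀ : EuclideanSpace ℝ (Fin n) → ℝ} {u : ℝ → EuclideanSpace ℝ (Fin n) → ℝ} {σ c₁ c₂ : ℝ}

/-- Bounded sets on which the total jump rate `∫ J(x,y) dy` is bounded, exhausting the space. -/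
def rateSublevel (J : EuclideanSpace ℝ (Fin n) → EuclideanSpace ℝ (Fin n) → ℝ) (k : ℕ) :
    Set (EuclideanSpace ℝ (Fin n)) := Metric.closedBall 0 k ∩ {x | ∫ y, J x y ≤ k}

theorem measurableSet_rateSublevel (hJ : Measurable (Function.uncurry J)) (k : ℕ) :
    MeasurableSet (rateSublevel J k) :=
  Metric.isClosed_closedBall.measurableSet.inter
    (measurableSet_le (hJ.stronglyMeasurable.integral_prod_right (ν := volume)).measurable
      measurable_const)

theorem volume_rateSublevel_ne_top (k : ℕ) : volume (rateSublevel J k) ≠ ∞ :=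
  measure_ne_top_of_subset Set.inter_subset_left measure_closedBall_lt_top.ne

theorem monotone_rateSublevel : Monotone (rateSublevel J) := fun k l hkl =>
  Set.inter_subset_inter (Metric.closedBall_subset_closedBall (by exact_mod_cast hkl))
    fun x hx => show ∫ y, J x y ≤ l from le_trans hx (by exact_mod_cast hkl)

theorem iUnion_rateSublevel : ⋃ k, rateSublevel J k = Set.univ := by
  refine Set.eq_univ_of_forall fun x => Set.mem_iUnion.2 ?_
  obtain ⟨k, hk⟩ := exists_nat_ge (max ‖x‖ (∫ y, J x y))
  exact ⟨k, by simpa using (le_max_left _ _).trans hk, (le_max_right _ _).trans hk⟩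

theorem tendsto_setIntegral_rateSublevel (hJ : Measurable (Function.uncurry J))
    {f : EuclideanSpace ℝ (Fin n) → ℝ} (hf : Integrable f volume) :
    Tendsto (fun k => ∫ x in rateSublevel J k, f x) atTop (𝓝 (∫ x, f x)) := by
  have := tendsto_setIntegral_of_monotone (μ := volume) (f := f)
    (measurableSet_rateSublevel (J := J) hJ) monotone_rateSublevel hf.integrableOn
  rwa [iUnion_rateSublevel, Measure.restrict_univ] at this

/-- Decay of a convex functional along a solution. The functional over a set of bounded jump rate
is differentiable in time; the mass outside tends to zero uniformly on compact time intervals by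
Dini's theorem. -/
theorem IsNonlocalHeatSolution.integral_convex_le (hJ : IsFatTailKernel n σ c₁ c₂ J)
    (hu : IsNonlocalHeatSolution J u₀ u) {Φ φ : ℝ → ℝ} {L h α β : ℝ}
    {S : Set (EuclideanSpace ℝ (Fin n))} (hS : MeasurableSet S) (hSf : volume S ≠ ∞)
    (hSs : ∀ z, -z ∈ S ↔ z ∈ S) (hh : 0 ≤ h) (hJS : ∀ x y, x - y ∈ S → h ≤ J x y)
    (hΦ : ∀ s, HasDerivAt Φ (φ s) s) (hΦ0 : ∀ s, 0 ≤ Φ s)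
    (hΦφ : ∀ s, Φ s ≤ φ s * s) (hφ : Monotone φ) (hφL : ∀ s, |φ s| ≤ L * |s|)
    (hα : 0 ≤ α) (hβ : 0 ≤ β) (hφαβ : ∀ s, |φ s| ≤ α + β * |s|)
    {s t m : ℝ} (hs : 0 < s) (hst : s ≤ t) (hm : ∀ τ ∈ Set.Icc s t, ∫ x, |u τ x| ≤ m) :
    ∫ x, Φ (u t x) ≤ Real.exp (-(h * volume.real S * (t - s))) * (∫ x, Φ (u s x))
      + (t - s) * (h * (α * volume.real S * m + β * m ^ 2)) := by
  obtain ⟨M, hM⟩ := hJ.bounded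
  have hM0 : 0 ≤ M := (hJ.nonneg 0 0).trans (hM 0 0)
  have hL0 : 0 ≤ L := by simpa using (abs_nonneg _).trans (hφL 1)
  have hm0 : 0 ≤ m := (integral_nonneg fun _ => abs_nonneg _).trans (hm s ⟨le_rfl, hst⟩)
  have hJm := hJ.continuous.measurable
  have hΦc : Continuous Φ := continuous_iff_continuousAt.2 fun s => (hΦ s).continuousAt
  have hpos : ∀ τ ∈ Set.Icc s t, 0 < τ := fun τ hτ => hs.trans_le hτ.1
  have hφm : ∀ τ, 0 < τ → AEStronglyMeasurable (fun x => φ (u τ x)) volume := fun τ hτ =>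
    (hφ.measurable.comp_aemeasurable (hu.integrable hτ.le).aemeasurable).aestronglyMeasurable
  have hφui : ∀ τ, 0 < τ → Integrable (fun x => φ (u τ x) * u τ x) volume := fun τ hτ => by
    refine ((hu.integrable_sq hτ.le).const_mul L).mono'
      ((hφm τ hτ).mul (hu.integrable hτ.le).1) (Eventually.of_forall fun x => ?_)
    rw [norm_mul, Real.norm_eq_abs, Real.norm_eq_abs]
    calc |φ (u τ x)| * |u τ x| ≤ (L * |u τ x|) * |u τ x| := by gcongr; exact hφL _
      _ = L * u τ x ^ 2 := by rw [← sq_abs (u τ x)]; ring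
  have hΦi : ∀ τ, 0 < τ → Integrable (fun x => Φ (u τ x)) volume := fun τ hτ =>
    (hφui τ hτ).mono' (hΦc.comp_aestronglyMeasurable (hu.integrable hτ.le).1)
      (Eventually.of_forall fun x => by rw [Real.norm_of_nonneg (hΦ0 _)]; exact hΦφ _)
  set a := h * volume.real S with ha
  have ha0 : 0 ≤ a := by positivity
  set G := h * (α * volume.real S * m + β * m ^ 2) with hG
  have hG0 : 0 ≤ G := by positivity
  -- uniform smallness of the mass outside the sublevel sets
  have hdini : TendstoUniformlyOn
      (fun (k : ℕ) τ => ∫ x in (rateSublevel J k)ᶜ, |u τ x|) (fun _ => 0) atTop (Set.Icc s t) := by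
    refine Antitone.tendstoUniformlyOn_of_forall_tendsto isCompact_Icc
      (fun k => (hu.continuousOn_setIntegral_abs _).mono fun τ hτ => (hpos τ hτ).le) ?_
      continuousOn_const ?_
    · intro τ hτ k l hkl
      exact setIntegral_mono_set (hu.integrable (hpos τ hτ).le).abs.integrableOn
        (Eventually.of_forall fun _ => abs_nonneg _)
        (LE.le.eventuallyLE (Set.compl_subset_compl.2 (monotone_rateSublevel hkl)))
    · intro τ hτ
      have hi := (hu.integrable (hpos τ hτ).le).abs
      have h1 := (tendsto_setIntegral_rateSublevel hJm hi).const_sub (∫ x, |u τ x|)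
      rw [sub_self] at h1
      refine h1.congr fun k => ?_
      rw [← integral_add_compl (measurableSet_rateSublevel hJm k) hi]
      ring
  have key : ∀ ε > 0, ∫ x, Φ (u t x) ≤ Real.exp (-(a * (t - s))) * (∫ x, Φ (u s x))
      + (t - s) * (G + M * (L * m) * ε) := by
    intro ε hε
    have hsm : ∀ᶠ k : ℕ in atTop, ∀ τ ∈ Set.Icc s t,
        ∫ x in (rateSublevel J k)ᶜ, |u τ x| ≤ ε := by
      filter_upwards [Metric.tendstoUniformlyOn_iff.1 hdini ε hε] with k hk τ hτ
      have := hk τ hτ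
      rw [Real.dist_eq, zero_sub, abs_neg] at this
      exact (le_abs_self _).trans this.le
    refine le_of_tendsto_of_tendsto
      (tendsto_setIntegral_rateSublevel hJm (hΦi t (hs.trans_le hst)))
      (((tendsto_setIntegral_rateSublevel hJm (hΦi s hs)).const_mul _).add_const _) ?_
    filter_upwards [hsm] with k hk
    refine le_exp_mul_add_of_deriv_le ha0 (by positivity) hst
      (fun τ hτ => hu.hasDerivAt_setIntegral hJ (measurableSet_rateSublevel hJm k)
        (volume_rateSublevel_ne_top k) (fun x hx => hx.2) hΦ hΦ0 hΦφ hφ hφL (hpos τ hτ)) ?_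
    intro τ hτ
    have hτ0 := (hpos τ hτ).le
    have hmain := setIntegral_kernel_diff_le_of_band (μ := volume) hJm hJ.nonneg hM hJ.symm
      hJ.integrable_right (measurableSet_rateSublevel hJm k) (fun x hx => hx.2) hS hSf hSs hh hJS
      hφ hφL hα hβ hφαβ (hu.integrable hτ0) (hu.integrable_sq hτ0)
    refine hmain.trans ?_
    have hmτ := hm τ hτ
    have hmτ0 : 0 ≤ ∫ x, |u τ x| := integral_nonneg fun _ => abs_nonneg _
    have h1 : ∫ x in rateSublevel J k, Φ (u τ x)
        ≤ ∫ x in rateSublevel J k, φ (u τ x) * u τ x :=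
      integral_mono (hΦi τ (hpos τ hτ)).restrict (hφui τ (hpos τ hτ)).restrict fun x => hΦφ _
    have h2 := mul_le_mul_of_nonneg_left h1 ha0
    have h3 : h * (α * volume.real S * (∫ x, |u τ x|) + β * (∫ x, |u τ x|) ^ 2) ≤ G := by
      rw [hG]; gcongr
    have h4 : M * (L * ∫ x, |u τ x|) * ∫ x in (rateSublevel J k)ᶜ, |u τ x|
        ≤ M * (L * m) * ε := by
      gcongr
      exact hk τ hτ
    linarith
  have hlim : Tendsto (fun ε : ℝ => Real.exp (-(a * (t - s))) * (∫ x, Φ (u s x))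
      + (t - s) * (G + M * (L * m) * ε)) (𝓝[>] 0)
      (𝓝 (Real.exp (-(a * (t - s))) * (∫ x, Φ (u s x)) + (t - s) * (G + M * (L * m) * 0))) :=
    (Continuous.tendsto (by fun_prop) 0).mono_left nhdsWithin_le_nhds
  rw [mul_zero, add_zero] at hlim
  exact ge_of_tendsto hlim (eventually_mem_nhdsWithin.mono fun ε hε => key ε hε)

theorem IsNonlocalHeatSolution.tendsto_integral_regPow (hu : IsNonlocalHeatSolution J u₀ u)
    {q : ℝ} (hq1 : 1 ≤ q) (hq2 : q ≤ 2) {t : ℝ} (ht : 0 ≤ t) :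
    Tendsto (fun d => ∫ x, regPow q d (u t x)) (𝓝[>] 0) (𝓝 ((∫ x, |u t x| ^ q) / q)) := by
  have hq0 : 0 < q := by linarith
  rw [← integral_div]
  refine tendsto_integral_filter_of_dominated_convergence (fun x => |u t x| ^ q) ?_ ?_
    (integrable_abs_rpow_of_memLp hq1 (hu.memLp_one t ht) (hu.memLp_top t ht))
    (Eventually.of_forall fun x => tendsto_regPow hq0 _)
  · filter_upwards [self_mem_nhdsWithin] with d hd
    have hc : Continuous (regPow q d) := continuous_iff_continuousAt.2 fun s =>
      (hasDerivAt_regPow hq0.ne' hd s).continuousAt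
    exact hc.comp_aestronglyMeasurable (hu.integrable ht).1
  · filter_upwards [self_mem_nhdsWithin] with d hd
    refine Eventually.of_forall fun x => ?_
    rw [Real.norm_of_nonneg (regPow_nonneg hq0 _)]
    exact regPow_le_rpow hq1 hq2 hd _

/-- Integrated energy inequality for the `L^q` norm, `1 ≤ q ≤ 2`, with dissipation coming from a
band `{x - y ∈ S}` on which the kernel is at least `h`. The level `l` is a free parameter that
splits `|u|^{q-1}` into its small and large parts. -/
theorem IsNonlocalHeatSolution.integral_rpow_le (hJ : IsFatTailKernel n σ c₁ c₂ J)
    (hu : IsNonlocalHeatSolution J u₀ u) {q h l : ℝ} (hq1 : 1 ≤ q) (hq2 : q ≤ 2) (hl : 0 < l)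
    {S : Set (EuclideanSpace ℝ (Fin n))} (hS : MeasurableSet S) (hSf : volume S ≠ ∞)
    (hSs : ∀ z, -z ∈ S ↔ z ∈ S) (hh : 0 ≤ h) (hJS : ∀ x y, x - y ∈ S → h ≤ J x y)
    {s t m : ℝ} (hs : 0 < s) (hst : s ≤ t) (hm : ∀ τ ∈ Set.Icc s t, ∫ x, |u τ x| ≤ m) :
    ∫ x, |u t x| ^ q ≤ Real.exp (-(h * volume.real S * (t - s))) * (∫ x, |u s x| ^ q)
      + (t - s) * (q * h * (l ^ (q - 1) * volume.real S * m + l ^ (q - 2) * m ^ 2)) := by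
  have hq0 : 0 < q := by linarith
  have h1 := le_of_tendsto_of_tendsto (hu.tendsto_integral_regPow hq1 hq2 (hs.le.trans hst))
    (((hu.tendsto_integral_regPow hq1 hq2 hs.le).const_mul
      (Real.exp (-(h * volume.real S * (t - s))))).add_const
      ((t - s) * (h * (l ^ (q - 1) * volume.real S * m + l ^ (q - 2) * m ^ 2)))) (by
      filter_upwards [self_mem_nhdsWithin] with d hd
      exact hu.integral_convex_le hJ hS hSf hSs hh hJS (hasDerivAt_regPow hq0.ne' hd)
        (regPow_nonneg hq0) (regPow_le_deriv_mul hq1 hd) (monotone_regPowDeriv hq1 hd)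
        (abs_regPowDeriv_le_linear hq2 hd) (by positivity) (by positivity)
        (abs_regPowDeriv_le_affine hq1 hq2 hl) hs hst hm)
  rw [div_le_iff₀ hq0] at h1
  refine h1.trans_eq ?_
  field_simp

theorem IsNonlocalHeatSolution.integral_rpow_anti (hJ : IsFatTailKernel n σ c₁ c₂ J)
    (hu : IsNonlocalHeatSolution J u₀ u) {q : ℝ} (hq1 : 1 ≤ q) (hq2 : q ≤ 2)
    {s t : ℝ} (hs : 0 < s) (hst : s ≤ t) : ∫ x, |u t x| ^ q ≤ ∫ x, |u s x| ^ q := by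
  have hc := (hu.continuousOn_setIntegral_abs Set.univ).mono
    (fun τ (hτ : τ ∈ Set.Icc s t) => (hs.le.trans hτ.1 : τ ∈ Set.Ici 0))
  simp only [Measure.restrict_univ] at hc
  obtain ⟨m, hm⟩ := (isCompact_Icc.image_of_continuousOn hc).bddAbove
  have := hu.integral_rpow_le hJ (h := 0) (S := ∅) (l := 1) hq1 hq2 one_pos MeasurableSet.empty
    (by simp) (by simp) le_rfl (by simp) hs hst (fun τ hτ => hm (Set.mem_image_of_mem _ hτ))
  simpa using this

/-- Contraction of the `L¹` norm. -/
theorem IsNonlocalHeatSolution.integral_abs_le (hJ : IsFatTailKernel n σ c₁ c₂ J)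
    (hu : IsNonlocalHeatSolution J u₀ u) {t : ℝ} (ht : 0 < t) :
    ∫ x, |u t x| ≤ ∫ x, |u₀ x| := by
  have hc := hu.continuousOn_setIntegral_abs Set.univ 0 Set.self_mem_Ici
  simp only [Measure.restrict_univ, ContinuousWithinAt] at hc
  have h0 : ∫ x, |u 0 x| = ∫ x, |u₀ x| := integral_congr_ae (hu.initial.fun_comp abs)
  rw [h0] at hc
  refine ge_of_tendsto (hc.mono_left (nhdsWithin_mono 0 Set.Ioi_subset_Ici_self)) ?_
  filter_upwards [Ioc_mem_nhdsGT ht] with s hs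
  simpa using hu.integral_rpow_anti hJ le_rfl one_le_two hs.1 hs.2

theorem IsNonlocalHeatSolution.tendsto_eLpNorm_sub (hu : IsNonlocalHeatSolution J u₀ u) {q : ℝ}
    (hq1 : 1 ≤ q) : Tendsto (fun s => eLpNorm (u s - u 0) (ENNReal.ofReal q) volume)
      (𝓝[>] 0) (𝓝 0) := by
  have hq0 : 0 < q := by linarith
  have hle : 𝓝[>] (0 : ℝ) ≤ 𝓝[Set.Ici 0] 0 := nhdsWithin_mono 0 Set.Ioi_subset_Ici_self
  have h1 := (hu.continuous_one 0 le_rfl).mono_left hle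
  have h2 := ((hu.continuous_top 0 le_rfl).mono_left hle).eventually_lt_const
    (zero_lt_one (α := ℝ≥0∞))
  have h3 : Tendsto (fun s => (eLpNorm (u s - u 0) 1 volume) ^ (1 / q)) (𝓝[>] 0) (𝓝 0) := by
    have := (ENNReal.continuous_rpow_const (y := 1 / q)).tendsto 0 |>.comp h1
    rwa [ENNReal.zero_rpow_of_pos (by positivity)] at this
  refine tendsto_of_tendsto_of_tendsto_of_le_of_le' tendsto_const_nhds h3
    (Eventually.of_forall fun _ => zero_le) ?_
  filter_upwards [h2] with s hs
  rw [eLpNorm_eq_lintegral_rpow_enorm_toReal (by simpa using hq0) (by simp),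
    ENNReal.toReal_ofReal hq0.le, eLpNorm_one_eq_lintegral_enorm]
  refine ENNReal.rpow_le_rpow (lintegral_mono_ae ?_) (by positivity)
  filter_upwards [ae_le_eLpNormEssSup (f := u s - u 0) (μ := volume)] with x hx
  rw [← eLpNorm_exponent_top] at hx
  calc ‖(u s - u 0) x‖ₑ ^ q ≤ ‖(u s - u 0) x‖ₑ ^ (1 : ℝ) :=
        ENNReal.rpow_le_rpow_of_exponent_ge (hx.trans hs.le) hq1
    _ = _ := ENNReal.rpow_one _

/-- Contraction of the `L^q` norm, in integral form. -/
theorem IsNonlocalHeatSolution.integral_rpow_le_initial (hJ : IsFatTailKernel n σ c₁ c₂ J)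
    (hu : IsNonlocalHeatSolution J u₀ u) {q : ℝ} (hq1 : 1 ≤ q) (hq2 : q ≤ 2)
    {t : ℝ} (ht : 0 < t) : ∫ x, |u t x| ^ q ≤ ∫ x, |u₀ x| ^ q := by
  have hq0 : 0 < q := by linarith
  have hY : ∀ s, 0 ≤ ∫ x, |u s x| ^ q := fun s => integral_nonneg fun _ => by positivity
  have h0 : ∫ x, |u 0 x| ^ q = ∫ x, |u₀ x| ^ q :=
    integral_congr_ae (hu.initial.fun_comp fun y => |y| ^ q)
  have heq : ∀ s, 0 ≤ s → eLpNorm (u s) (ENNReal.ofReal q) volume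
      = ENNReal.ofReal ((∫ x, |u s x| ^ q) ^ (1 / q)) := fun s hs =>
    eLpNorm_ofReal_eq_integral hq1 (hu.memLp_one s hs) (hu.memLp_top s hs)
  have hle : eLpNorm (u t) (ENNReal.ofReal q) volume ≤ eLpNorm (u 0) (ENNReal.ofReal q) volume := by
    have hlim := (hu.tendsto_eLpNorm_sub hq1).const_add (eLpNorm (u 0) (ENNReal.ofReal q) volume)
    rw [add_zero] at hlim
    refine ge_of_tendsto hlim ?_
    filter_upwards [Ioc_mem_nhdsGT ht] with s hs
    have h1 : eLpNorm (u t) (ENNReal.ofReal q) volume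
        ≤ eLpNorm (u s) (ENNReal.ofReal q) volume := by
      rw [heq t ht.le, heq s hs.1.le]
      exact ENNReal.ofReal_le_ofReal (Real.rpow_le_rpow (hY t)
        (hu.integral_rpow_anti hJ hq1 hq2 hs.1 hs.2) (by positivity))
    have h2 := eLpNorm_add_le (hu.integrable le_rfl).1
      ((hu.integrable hs.1.le).sub (hu.integrable le_rfl)).1
      (p := ENNReal.ofReal q) (by simpa using ENNReal.ofReal_le_ofReal hq1)
    rw [add_sub_cancel] at h2
    exact h1.trans h2
  rw [heq t ht.le, heq 0 le_rfl,
    ENNReal.ofReal_le_ofReal_iff (Real.rpow_nonneg (hY 0) _),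
    Real.rpow_le_rpow_iff (hY t) (hY 0) (by positivity), h0] at hle
  exact hle

end Solution

/-! ### Decay by doubling the time -/

theorem le_of_halving_recursion {Z : ℝ → ℝ} {A B t₀ : ℝ} (ht₀ : 0 < t₀) (hA : 0 ≤ A)
    (hB : ∀ t ∈ Set.Icc t₀ (2 * t₀), Z t ≤ B) (hB0 : 0 ≤ B)
    (hZ : ∀ t, t₀ ≤ t → Z (2 * t) ≤ (Z t + A) / 2) {t : ℝ} (ht : t₀ ≤ t) :
    Z t ≤ A + 2 * t₀ * B / t := by
  have key : ∀ k : ℕ, ∀ t ∈ Set.Icc t₀ (2 ^ (k + 1) * t₀), Z t ≤ A + 2 * t₀ * B / t := by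
    intro k
    induction k with
    | zero =>
      intro t ht
      have ht' : t ∈ Set.Icc t₀ (2 * t₀) := by simpa using ht
      have htpos := ht₀.trans_le ht'.1
      have : B ≤ 2 * t₀ * B / t := by
        rw [le_div_iff₀ htpos]; nlinarith [ht'.2]
      linarith [hB t ht']
    | succ k ih =>
      intro t ht
      have htpos := ht₀.trans_le ht.1
      rcases le_total t (2 * t₀) with h | h
      · have : B ≤ 2 * t₀ * B / t := by
          rw [le_div_iff₀ htpos]; nlinarith
        linarith [hB t ⟨ht.1, h⟩]
      · have h1 := ih (t / 2) ⟨by linarith, by have := ht.2; rw [pow_succ] at this; linarith⟩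
        have h2 := hZ (t / 2) (by linarith)
        have h3 : 2 * t₀ * B / (t / 2) = 2 * (2 * t₀ * B / t) := by field_simp
        rw [mul_div_cancel₀ t two_ne_zero] at h2
        linarith
  obtain ⟨k, hk⟩ := pow_unbounded_of_one_lt (t / t₀) (one_lt_two (α := ℝ))
  refine key k t ⟨ht, ?_⟩
  rw [div_lt_iff₀ ht₀] at hk
  have : (0 : ℝ) < 2 ^ k * t₀ := by positivity
  rw [pow_succ]
  linarith

theorem le_mul_rpow_of_forall_gt {y A B m q : ℝ} (hq : 0 < q)
    (h : ∀ N, m < N → y ≤ A * N ^ q + B) : y ≤ A * m ^ q + B := by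
  have hc : Continuous fun N : ℝ => A * N ^ q + B :=
    (continuous_const.mul (Real.continuous_rpow_const hq.le)).add continuous_const
  exact ge_of_tendsto ((hc.tendsto m).mono_left nhdsWithin_le_nhds)
    (eventually_mem_nhdsWithin.mono fun N (hN : N ∈ Set.Ioi m) => h N hN)

theorem volume_real_annulus {n : ℕ} {R : ℝ} (hR : 0 < R) :
    volume.real (Metric.ball (0 : EuclideanSpace ℝ (Fin n)) (2 * R) \ Metric.closedBall 0 R)
      = volume.real (Metric.ball (0 : EuclideanSpace ℝ (Fin n)) 1) * (2 ^ n - 1) * R ^ n := by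
  rw [measureReal_sdiff (Metric.closedBall_subset_ball (by linarith))
    Metric.isClosed_closedBall.measurableSet measure_ball_lt_top.ne]
  rw [measureReal_def, measureReal_def, measureReal_def,
    Measure.addHaar_ball_of_pos _ _ (by positivity : 0 < 2 * R),
    Measure.addHaar_closedBall _ _ hR.le, finrank_euclideanSpace_fin, ENNReal.toReal_mul,
    ENNReal.toReal_mul, ENNReal.toReal_ofReal (by positivity), ENNReal.toReal_ofReal (by positivity)]
  ring

/-- Bookkeeping of the powers of the radius `R`, the time `t` and the level `N / R ^ n`. -/
theorem dissipation_constants {n : ℕ} {σ q b t w N R : ℝ} (hσ : 0 < σ)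
    (hb : 0 < b) (ht : 0 < t) (hN : 0 < N) (hR : R = (t / b) ^ (1 / (2 * σ))) :
    (2 * R) ^ (-((n : ℝ) + 2 * σ)) * (w * R ^ n) * t
        = (2 : ℝ) ^ (-((n : ℝ) + 2 * σ)) * w * b ∧
      t * ((2 * R) ^ (-((n : ℝ) + 2 * σ)) * ((N / R ^ n) ^ (q - 1) * (w * R ^ n) * N
          + (N / R ^ n) ^ (q - 2) * N ^ 2))
        = (2 : ℝ) ^ (-((n : ℝ) + 2 * σ)) * (w + 1) * b *
          (b ^ ((n : ℝ) * (q - 1) / (2 * σ)) * t ^ (-((n : ℝ) * (q - 1) / (2 * σ)))) * N ^ q := by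
  have hRpos : 0 < R := by rw [hR]; positivity
  have hR2 : R ^ (2 * σ) = t / b := by
    rw [hR, ← Real.rpow_mul (by positivity), one_div_mul_cancel (by positivity), Real.rpow_one]
  have hRn : (R ^ n) ^ (-(q - 1))
      = b ^ ((n : ℝ) * (q - 1) / (2 * σ)) * t ^ (-((n : ℝ) * (q - 1) / (2 * σ))) := by
    have e : (n : ℝ) * -(q - 1) = 2 * σ * -((n : ℝ) * (q - 1) / (2 * σ)) := by field_simp
    rw [← Real.rpow_natCast R n, ← Real.rpow_mul hRpos.le, e, Real.rpow_mul hRpos.le, hR2,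
      Real.div_rpow ht.le hb.le, Real.rpow_neg hb.le, div_inv_eq_mul, mul_comm]
  have hh : (2 * R) ^ (-((n : ℝ) + 2 * σ)) * R ^ n * t
      = (2 : ℝ) ^ (-((n : ℝ) + 2 * σ)) * b := by
    rw [Real.mul_rpow two_pos.le hRpos.le, Real.rpow_neg hRpos.le, Real.rpow_add hRpos, hR2,
      Real.rpow_natCast]
    field_simp
  have hl1 : (N / R ^ n) ^ (q - 1) * N = N ^ q * (R ^ n) ^ (-(q - 1)) := by
    rw [Real.div_rpow hN.le (by positivity), Real.rpow_neg (by positivity),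
      Real.rpow_sub_one hN.ne']
    field_simp
  have hl2 : (N / R ^ n) ^ (q - 2) * N ^ 2 = N ^ q * (R ^ n) ^ (-(q - 1)) * R ^ n := by
    have e : q - 2 = q - 1 - 1 := by ring
    rw [e, Real.rpow_sub_one (by positivity), ← hl1]
    field_simp
  constructor
  · linear_combination w * hh
  · rw [hl2, mul_right_comm ((N / R ^ n) ^ (q - 1)), hl1, ← hRn]
    linear_combination (N ^ q * (R ^ n) ^ (-(q - 1)) * (w + 1)) * hh

section Solution

variable {n : ℕ} {J : EuclideanSpace ℝ (Fin n) → EuclideanSpace ℝ (Fin n) → ℝ}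
  {u₀ : EuclideanSpace ℝ (Fin n) → ℝ} {u : ℝ → EuclideanSpace ℝ (Fin n) → ℝ} {σ c₁ c₂ : ℝ}

/-- Between the times `t` and `2t` the dissipation is measured on the band of width
`R = (t / b)^{1/(2σ)}`. -/
theorem IsNonlocalHeatSolution.integral_rpow_two_mul_le (hJ : IsFatTailKernel n σ c₁ c₂ J)
    (hu : IsNonlocalHeatSolution J u₀ u) {q b t N w : ℝ} (hq1 : 1 ≤ q) (hq2 : q ≤ 2)
    (hσ : 0 < σ) (hc₁ : 0 < c₁) (hc₂ : 0 < c₂) (hb : 0 < b) (ht : b * c₂ ^ (2 * σ) ≤ t)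
    (hw : w = volume.real (Metric.ball (0 : EuclideanSpace ℝ (Fin n)) 1) * (2 ^ n - 1))
    (hN : ∫ x, |u₀ x| < N) :
    ∫ x, |u (2 * t) x| ^ q
      ≤ Real.exp (-(c₁ * 2 ^ (-((n : ℝ) + 2 * σ)) * w * b)) * (∫ x, |u t x| ^ q)
        + q * (c₁ * 2 ^ (-((n : ℝ) + 2 * σ)) * (w + 1) * b *
          (b ^ ((n : ℝ) * (q - 1) / (2 * σ)) * t ^ (-((n : ℝ) * (q - 1) / (2 * σ)))) * N ^ q) := by
  have ht0 : 0 < t := lt_of_lt_of_le (by positivity) ht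
  have hN0 : 0 < N := (integral_nonneg fun _ => abs_nonneg _).trans_lt hN
  set R := (t / b) ^ (1 / (2 * σ)) with hR
  have hRpos : 0 < R := by positivity
  have hRc : c₂ ≤ R := by
    have h1 : c₂ ^ (2 * σ) ≤ t / b := by rw [le_div_iff₀ hb]; linarith
    have h2 := Real.rpow_le_rpow (by positivity) h1 (by positivity : 0 ≤ 1 / (2 * σ))
    rwa [← Real.rpow_mul hc₂.le, mul_one_div_cancel (by positivity), Real.rpow_one] at h2
  set S := Metric.ball (0 : EuclideanSpace ℝ (Fin n)) (2 * R) \ Metric.closedBall 0 R with hS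
  have hSv : volume.real S = w * R ^ n := by rw [hS, volume_real_annulus hRpos, hw]
  have hmain := hu.integral_rpow_le hJ (q := q) (h := c₁ * (2 * R) ^ (-((n : ℝ) + 2 * σ)))
    (l := N / R ^ n) (S := S) (s := t) (t := 2 * t) (m := N) hq1 hq2 (by positivity)
    (Metric.isOpen_ball.measurableSet.diff Metric.isClosed_closedBall.measurableSet)
    (measure_ne_top_of_subset Set.sdiff_subset measure_ball_lt_top.ne)
    (fun z => by simp [hS]) (by positivity)
    (fun x y hxy => by
      have hlt : ‖x - y‖ < 2 * R := by simpa using hxy.1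
      have hgt : R < ‖x - y‖ := by simpa using hxy.2
      refine le_trans ?_ (hJ.tail x y (hRc.trans_lt hgt))
      refine mul_le_mul_of_nonneg_left ?_ hc₁.le
      exact Real.rpow_le_rpow_of_nonpos (hRpos.trans hgt) hlt.le
        (by have : (0 : ℝ) ≤ n := n.cast_nonneg; linarith))
    ht0 (by linarith)
    (fun τ hτ => (hu.integral_abs_le hJ (ht0.trans_le hτ.1)).trans hN.le)
  obtain ⟨e1, e2⟩ := dissipation_constants (n := n) (q := q) (w := w) hσ hb ht0 hN0 hR
  rw [hSv] at hmain
  refine hmain.trans_eq ?_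
  congr 1
  · congr 3
    linear_combination c₁ * e1
  · linear_combination (q * c₁) * e2

/-- Large-time decay with constants independent of the kernel and the solution. The influence of
`‖u₀‖_q` disappears as `t → ∞`. -/
theorem exists_rpow_mul_integral_le (hn : 1 ≤ n) (hσ : 0 < σ) (hc₁ : 0 < c₁) (hc₂ : 0 < c₂)
    {q : ℝ} (hq1 : 1 ≤ q) (hq2 : q ≤ 2) :
    ∃ D ≥ 0, ∃ t₀ > 0, ∀ J : EuclideanSpace ℝ (Fin n) → EuclideanSpace ℝ (Fin n) → ℝ,
      IsFatTailKernel n σ c₁ c₂ J → ∀ u₀ u, IsNonlocalHeatSolution J u₀ u → ∀ t, t₀ ≤ t →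
      t ^ ((n : ℝ) * (q - 1) / (2 * σ)) * ∫ x, |u t x| ^ q ≤ D * (∫ x, |u₀ x|) ^ q +
        2 * t₀ * ((2 * t₀) ^ ((n : ℝ) * (q - 1) / (2 * σ)) * ∫ x, |u₀ x| ^ q) / t := by
  set β := (n : ℝ) * (q - 1) / (2 * σ) with hβ
  have hβ0 : 0 ≤ β := by
    have : 0 ≤ q - 1 := by linarith
    positivity
  obtain ⟨w, hw⟩ : ∃ w, w = volume.real (Metric.ball (0 : EuclideanSpace ℝ (Fin n)) 1) *
    (2 ^ n - 1) := ⟨_, rfl⟩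
  have hw0 : 0 < w := by
    have h1 : (0 : ℝ) < 2 ^ n - 1 := by
      have := one_lt_pow₀ (one_lt_two (α := ℝ)) (Nat.one_le_iff_ne_zero.1 hn)
      linarith
    have h2 : 0 < volume.real (Metric.ball (0 : EuclideanSpace ℝ (Fin n)) 1) :=
      ENNReal.toReal_pos (Metric.measure_ball_pos _ _ one_pos).ne' measure_ball_lt_top.ne
    rw [hw]; positivity
  set κ := c₁ * (2 : ℝ) ^ (-((n : ℝ) + 2 * σ)) with hκ
  have hκ0 : 0 < κ := by positivity
  -- chosen so that one doubling of time gains the factor `2^{-β-1}`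
  set b := (β + 1) * Real.log 2 / (κ * w) with hb
  have hlog : 0 < Real.log 2 := Real.log_pos one_lt_two
  have hb0 : 0 < b := by positivity
  have hexp : Real.exp (-(κ * w * b)) = (2 : ℝ) ^ (-(β + 1)) := by
    rw [Real.rpow_def_of_pos two_pos]
    congr 1
    rw [hb]; field_simp
  set D := 2 * (2 ^ β * (q * (κ * (w + 1) * b * b ^ β))) with hD
  have hq0 : 0 < q := by linarith
  have hD0 : 0 ≤ D := by positivity
  refine ⟨D, hD0, b * c₂ ^ (2 * σ), by positivity, ?_⟩
  intro J hJ u₀ u hu t ht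
  set t₀ := b * c₂ ^ (2 * σ) with ht₀
  have ht₀0 : 0 < t₀ := by positivity
  have hY0 : 0 ≤ ∫ x, |u₀ x| ^ q := integral_nonneg fun _ => by positivity
  refine le_mul_rpow_of_forall_gt hq0 fun N hN => ?_
  have hN0 : 0 ≤ N := (integral_nonneg fun _ => abs_nonneg _).trans hN.le
  refine le_of_halving_recursion (Z := fun t => t ^ β * ∫ x, |u t x| ^ q) ht₀0
    (by positivity) ?_ (by positivity) ?_ ht
  · intro s hs
    have hs0 := ht₀0.trans_le hs.1
    exact mul_le_mul (Real.rpow_le_rpow hs0.le hs.2 hβ0)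
      (hu.integral_rpow_le_initial hJ hq1 hq2 hs0) (integral_nonneg fun _ => by positivity)
      (by positivity)
  · intro s hs
    have hs0 := ht₀0.trans_le hs
    have h1 := hu.integral_rpow_two_mul_le hJ hq1 hq2 hσ hc₁ hc₂ hb0 hs hw hN
    rw [← hκ, ← hβ, hexp] at h1
    have h2 := mul_le_mul_of_nonneg_left h1 (by positivity : 0 ≤ (2 * s) ^ β)
    refine h2.trans_eq ?_
    rw [Real.mul_rpow two_pos.le hs0.le, Real.rpow_neg two_pos.le, Real.rpow_add two_pos,
      Real.rpow_one, Real.rpow_neg hs0.le, hD]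
    field_simp

end Solution

/-! ### Interpolation and the decay estimates -/

/-- Interpolation of `∫ |f|^q` between the exponents `1` and `r`, with a common bound `N`. -/
theorem integral_abs_rpow_le_two_mul {X : Type*} [MeasurableSpace X] {μ : Measure X} {f : X → ℝ}
    {q r N : ℝ} (hq : 1 ≤ q) (hqr : q ≤ r) (hN : 0 < N) (h1 : MemLp f 1 μ) (h2 : MemLp f ∞ μ)
    (hN1 : ∫ x, |f x| ∂μ ≤ N) (hNr : ∫ x, |f x| ^ r ∂μ ≤ N ^ r) :
    ∫ x, |f x| ^ q ∂μ ≤ 2 * N ^ q := by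
  have hf := (memLp_one_iff_integrable.1 h1).abs
  have hfq := integrable_abs_rpow_of_memLp hq h1 h2
  have hfr := integrable_abs_rpow_of_memLp (hq.trans hqr) h1 h2
  have hpt : ∀ x, |f x| ^ q ≤ N ^ q * (|f x| / N + |f x| ^ r / N ^ r) := fun x => by
    have h0 : 0 ≤ |f x| / N := by positivity
    have h3 : (|f x| / N) ^ q ≤ |f x| / N + (|f x| / N) ^ r := by
      rcases le_total (|f x| / N) 1 with h | h
      · have := Real.rpow_le_rpow_of_exponent_ge' h0 h zero_le_one hq
        rw [Real.rpow_one] at this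
        have : 0 ≤ (|f x| / N) ^ r := by positivity
        linarith
      · have := Real.rpow_le_rpow_of_exponent_le h hqr
        linarith
    rw [Real.div_rpow (abs_nonneg _) hN.le, Real.div_rpow (abs_nonneg _) hN.le,
      div_le_iff₀ (by positivity)] at h3
    linarith
  calc ∫ x, |f x| ^ q ∂μ ≤ ∫ x, N ^ q * (|f x| / N + |f x| ^ r / N ^ r) ∂μ :=
        integral_mono hfq (((hf.div_const N).add (hfr.div_const (N ^ r))).const_mul _) hpt
    _ = N ^ q * ((∫ x, |f x| ∂μ) / N + (∫ x, |f x| ^ r ∂μ) / N ^ r) := by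
        rw [integral_const_mul, integral_add (hf.div_const N) (hfr.div_const _), integral_div,
          integral_div]
    _ ≤ N ^ q * (1 + 1) := by
        gcongr
        · exact (div_le_one hN).2 hN1
        · exact (div_le_one (by positivity)).2 hNr
    _ = 2 * N ^ q := by ring

theorem ofReal_mul_eLpNorm_eq {X : Type*} [MeasurableSpace X] {μ : Measure X} {f : X → ℝ}
    {q t γ : ℝ} (hq : 1 ≤ q) (ht : 0 < t) (h1 : MemLp f 1 μ) (h2 : MemLp f ∞ μ) :
    ENNReal.ofReal (t ^ γ) * eLpNorm f (ENNReal.ofReal q) μ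
      = ENNReal.ofReal ((t ^ (γ * q) * ∫ x, |f x| ^ q ∂μ) ^ (1 / q)) := by
  have hq0 : 0 < q := by linarith
  rw [eLpNorm_ofReal_eq_integral hq h1 h2, ← ENNReal.ofReal_mul (by positivity),
    Real.mul_rpow (by positivity) (integral_nonneg fun _ => by positivity),
    ← Real.rpow_mul ht.le, mul_assoc, mul_one_div_cancel hq0.ne', mul_one]

theorem corollary1 (n : ℕ) (hn : 2 ≤ n) (σ : ℝ) (hσ : σ ∈ Set.Ioo (0 : ℝ) 1)
    (c₁ c₂ : ℝ) (hc₁ : 0 < c₁) (hc₂ : 0 < c₂)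
    (q : ℝ) (hq : q ∈ Set.Ioc (1 : ℝ) (2 * σ)) :
    (∃ C : ℝ≥0, ∀ J : EuclideanSpace ℝ (Fin n) → EuclideanSpace ℝ (Fin n) → ℝ,
      IsFatTailKernel n σ c₁ c₂ J →
      ∀ u₀ : EuclideanSpace ℝ (Fin n) → ℝ, MemLp u₀ 1 volume → MemLp u₀ ∞ volume →
      ∀ u : ℝ → EuclideanSpace ℝ (Fin n) → ℝ, IsNonlocalHeatSolution J u₀ u →
        limsup (fun t : ℝ => ENNReal.ofReal (t ^ ((n : ℝ) / (2 * σ) * (1 - 1 / q))) *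
            eLpNorm (u t) (ENNReal.ofReal q) volume) atTop
          ≤ (C : ℝ≥0∞) * eLpNorm u₀ 1 volume) ∧
    (∀ r : ℝ, 2 * σ < r →
      ∃ C : ℝ≥0, ∀ J : EuclideanSpace ℝ (Fin n) → EuclideanSpace ℝ (Fin n) → ℝ,
        IsFatTailKernel n σ c₁ c₂ J →
        ∀ u₀ : EuclideanSpace ℝ (Fin n) → ℝ, MemLp u₀ 1 volume → MemLp u₀ ∞ volume →
        ∀ u : ℝ → EuclideanSpace ℝ (Fin n) → ℝ, IsNonlocalHeatSolution J u₀ u →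
        ∀ t : ℝ, 0 < t →
          eLpNorm (u t) (ENNReal.ofReal q) volume
            ≤ (C : ℝ≥0∞) *
              max (eLpNorm u₀ 1 volume) (eLpNorm u₀ (ENNReal.ofReal r) volume) *
              ENNReal.ofReal (t ^ (-((n : ℝ) / (2 * σ) * (1 - 1 / q))))) := by
  obtain ⟨hq1, hqσ⟩ := hq
  have hσ0 := hσ.1
  have hq1' := hq1.le
  have hq0 : 0 < q := by linarith
  have hq2 : q ≤ 2 := by linarith [hσ.2]
  obtain ⟨D, hD, t₀, ht₀, hdec⟩ :=
    exists_rpow_mul_integral_le (n := n) (by omega) hσ0 hc₁ hc₂ hq1' hq2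
  set γ := (n : ℝ) / (2 * σ) * (1 - 1 / q) with hγ
  have hγq : (n : ℝ) * (q - 1) / (2 * σ) = γ * q := by rw [hγ]; field_simp
  rw [hγq] at hdec
  have hγ0 : 0 ≤ γ := by
    have : 0 ≤ 1 - 1 / q := sub_nonneg.2 ((div_le_one hq0).2 hq1')
    positivity
  have hL1 : ∀ f : EuclideanSpace ℝ (Fin n) → ℝ, MemLp f 1 volume → MemLp f ∞ volume →
      eLpNorm f 1 volume = ENNReal.ofReal (∫ x, |f x|) := fun f h1 h2 => by
    simpa using eLpNorm_ofReal_eq_integral le_rfl h1 h2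
  have hroot : ∀ C m : ℝ, 0 ≤ C → 0 ≤ m → (C * m ^ q) ^ (1 / q) = C ^ (1 / q) * m :=
    fun C m hC hm => by
      rw [Real.mul_rpow hC (by positivity), ← Real.rpow_mul hm, mul_one_div_cancel hq0.ne',
        Real.rpow_one]
  refine ⟨⟨(D ^ (1 / q)).toNNReal, ?_⟩, fun r hr => ?_⟩
  · intro J hJ u₀ h1 h2 u hu
    set E := 2 * t₀ * ((2 * t₀) ^ (γ * q) * ∫ x, |u₀ x| ^ q) with hE
    have hm0 : 0 ≤ ∫ x, |u₀ x| := integral_nonneg fun _ => abs_nonneg _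
    have hlim : Tendsto (fun t : ℝ => ENNReal.ofReal ((D * (∫ x, |u₀ x|) ^ q + E / t) ^ (1 / q)))
        atTop (𝓝 (ENNReal.ofReal ((D * (∫ x, |u₀ x|) ^ q + 0) ^ (1 / q)))) :=
      ENNReal.tendsto_ofReal (((tendsto_const_nhds.div_atTop tendsto_id).const_add _).rpow_const
        (Or.inr (by positivity)))
    have hle : (fun t : ℝ => ENNReal.ofReal (t ^ γ) * eLpNorm (u t) (ENNReal.ofReal q) volume)
        ≤ᶠ[atTop] fun t => ENNReal.ofReal ((D * (∫ x, |u₀ x|) ^ q + E / t) ^ (1 / q)) := by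
      filter_upwards [eventually_ge_atTop t₀] with t ht
      have ht0 := ht₀.trans_le ht
      rw [ofReal_mul_eLpNorm_eq hq1' ht0 (hu.memLp_one t ht0.le) (hu.memLp_top t ht0.le)]
      have hY : 0 ≤ ∫ x, |u t x| ^ q := integral_nonneg fun _ => by positivity
      exact ENNReal.ofReal_le_ofReal (Real.rpow_le_rpow (by positivity)
        (hdec J hJ u₀ u hu t ht) (by positivity))
    refine (limsup_le_limsup hle).trans_eq ?_
    rw [hlim.limsup_eq, add_zero, hroot _ _ hD hm0, ENNReal.ofReal_mul (by positivity), hL1 u₀ h1 h2]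
    rfl
  · set D' := D + 4 * (2 * t₀) ^ (γ * q) + 2 * t₀ ^ (γ * q) with hD'
    have hD'0 : 0 ≤ D' := by positivity
    refine ⟨(D' ^ (1 / q)).toNNReal, ?_⟩
    intro J hJ u₀ h1 h2 u hu t ht
    have hr1 : 1 ≤ r := by linarith
    have hr0 : 0 < r := by linarith
    have hm0 : 0 ≤ ∫ x, |u₀ x| := integral_nonneg fun _ => abs_nonneg _
    have hmr0 : 0 ≤ ∫ x, |u₀ x| ^ r := integral_nonneg fun _ => by positivity
    set N₀ := max (∫ x, |u₀ x|) ((∫ x, |u₀ x| ^ r) ^ (1 / r)) with hN₀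
    have hN₀0 : 0 ≤ N₀ := hm0.trans (le_max_left _ _)
    have hmax : max (eLpNorm u₀ 1 volume) (eLpNorm u₀ (ENNReal.ofReal r) volume)
        = ENNReal.ofReal N₀ := by
      rw [hL1 u₀ h1 h2, eLpNorm_ofReal_eq_integral hr1 h1 h2, hN₀,
        ENNReal.ofReal_mono.map_max]
    have hY : 0 ≤ ∫ x, |u t x| ^ q := integral_nonneg fun _ => by positivity
    have hmain : t ^ (γ * q) * ∫ x, |u t x| ^ q ≤ D' * N₀ ^ q + 0 := by
      refine le_mul_rpow_of_forall_gt hq0 fun N hN => ?_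
      have hN0 : 0 < N := hN₀0.trans_lt hN
      have hmN : ∫ x, |u₀ x| ≤ N := (le_max_left _ _).trans hN.le
      have hrN : ∫ x, |u₀ x| ^ r ≤ N ^ r := by
        have h3 := Real.rpow_le_rpow (by positivity) ((le_max_right _ _).trans hN.le) hr0.le
        rwa [← Real.rpow_mul hmr0, one_div_mul_cancel hr0.ne', Real.rpow_one] at h3
      have hY0 : ∫ x, |u₀ x| ^ q ≤ 2 * N ^ q :=
        integral_abs_rpow_le_two_mul hq1' (hqσ.trans hr.le) hN0 h1 h2 hmN hrN
      have hNq : 0 ≤ N ^ q := by positivity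
      have ha : 0 ≤ (2 * t₀) ^ (γ * q) := by positivity
      have hb : 0 ≤ t₀ ^ (γ * q) := by positivity
      rw [add_zero, hD']
      rcases le_total t₀ t with h | h
      · calc t ^ (γ * q) * ∫ x, |u t x| ^ q
            ≤ D * (∫ x, |u₀ x|) ^ q
              + 2 * t₀ * ((2 * t₀) ^ (γ * q) * ∫ x, |u₀ x| ^ q) / t := hdec J hJ u₀ u hu t h
          _ ≤ D * N ^ q + 2 * t₀ * ((2 * t₀) ^ (γ * q) * (2 * N ^ q)) / t₀ := by gcongr
          _ = (D + 4 * (2 * t₀) ^ (γ * q)) * N ^ q := by field_simp; ring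
          _ ≤ _ := mul_le_mul_of_nonneg_right (by linarith) hNq
      · calc t ^ (γ * q) * ∫ x, |u t x| ^ q
            ≤ t₀ ^ (γ * q) * (2 * N ^ q) := by
              gcongr
              exact (hu.integral_rpow_le_initial hJ hq1' hq2 ht).trans hY0
          _ = (2 * t₀ ^ (γ * q)) * N ^ q := by ring
          _ ≤ _ := mul_le_mul_of_nonneg_right (by linarith) hNq
    have hfin : ENNReal.ofReal (t ^ γ) * eLpNorm (u t) (ENNReal.ofReal q) volume
        ≤ ENNReal.ofReal (D' ^ (1 / q)) * ENNReal.ofReal N₀ := by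
      rw [ofReal_mul_eLpNorm_eq hq1' ht (hu.memLp_one t ht.le) (hu.memLp_top t ht.le),
        ← ENNReal.ofReal_mul (by positivity), ← hroot _ _ hD'0 hN₀0]
      rw [add_zero] at hmain
      exact ENNReal.ofReal_le_ofReal (Real.rpow_le_rpow (by positivity) hmain (by positivity))
    have hinv : ENNReal.ofReal (t ^ (-γ)) * ENNReal.ofReal (t ^ γ) = 1 := by
      rw [← ENNReal.ofReal_mul (by positivity), ← Real.rpow_add ht, neg_add_cancel, Real.rpow_zero,
        ENNReal.ofReal_one]
    calc eLpNorm (u t) (ENNReal.ofReal q) volume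
        = ENNReal.ofReal (t ^ (-γ)) *
            (ENNReal.ofReal (t ^ γ) * eLpNorm (u t) (ENNReal.ofReal q) volume) := by
          rw [← mul_assoc, hinv, one_mul]
      _ ≤ ENNReal.ofReal (t ^ (-γ)) *
            (ENNReal.ofReal (D' ^ (1 / q)) * ENNReal.ofReal N₀) := by gcongr
      _ = _ := by rw [hmax, mul_comm]; rfl
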